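/- Let $K$ be an algebraically closed field of characteristic $0$, let $f\colon L\to L'$ be a morphism of Lie algebras over $K$ (of arbitrary dimension), let $\ker f\subseteq L$ be its kernel and $i\colon \ker f\to L$ the inclusion. Universal enveloping algebras carry their usual cocommutative Hopf algebra structure, in which the elements of the Lie algebra are primitive: $\Delta(x)=x\otimes 1+1\otimes x$, $\varepsilon(x)=0$, $S(x)=-x$. Let $\mathbf{Hopf}_{K,coc}$ be the category of cocommutative Hopf $K$-algebras and Hopf algebra morphisms, whose zero morphisms $A\to B$ are the maps $a\mapsto\varepsilon_A(a)1_B$. Then the Hopf kernel of $U(f)\colon U(L)\to U(L')$ is $U(\ker f)$. Precisely: 1. $U(i)\colon U(\ker f)\to U(L)$ is a kernel of $U(f)$ in the category $\mathbf{Hopf}_{K,coc}$; 2. $U(i)$ is injective, and its image is the subalgebra $$\mathrm{HKer}(U(f))=\{h\in U(L)\mid U(f)(h_1)\otimes h_2=1\otimes h \text{ in } U(L')\otimes U(L)\},$$ where $\Delta(h)=h_1\otimes h_2$ in Sweedler notation. -/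

import Mathlib

open CategoryTheory CategoryTheory.Limits
open scoped TensorProduct

universe u v

/-! ### The Hopf algebra structure on a universal enveloping algebra -/

noncomputable section

namespace UniversalEnvelopingAlgebra

attribute [local instance 100] LieRing.ofAssociativeRing

variable (K : Type*) [Field K]
variable {L L' : Type*} [LieRing L] [LieAlgebra K L] [LieRing L'] [LieAlgebra K L']

/-- Two algebra maps out of `U(L)` that agree on `L` are equal. -/
theorem algHom_ext_ι {A : Type*} [Ring A] [Algebra K A]
    {g₁ g₂ : UniversalEnvelopingAlgebra K L →ₐ[K] A}
    (h : ∀ x : L, g₁ (ι K x) = g₂ (ι K x)) : g₁ = g₂ :=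
  hom_ext K (LieHom.ext h)

/-- The Lie algebra map `L → U(L) ⊗ U(L)`, `x ↦ x ⊗ 1 + 1 ⊗ x`. -/
def comulLie : L →ₗ⁅K⁆
    UniversalEnvelopingAlgebra K L ⊗[K] UniversalEnvelopingAlgebra K L where
  toFun x := ι K x ⊗ₜ[K] 1 + 1 ⊗ₜ[K] ι K x
  map_add' x y := by
    simp only [map_add, TensorProduct.add_tmul, TensorProduct.tmul_add]; abel
  map_smul' c x := by
    simp only [map_smul, TensorProduct.smul_tmul', TensorProduct.tmul_smul, smul_add,
      RingHom.id_apply]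
  map_lie' {x y} := by
    simp only [LieHom.map_lie, LieRing.of_associative_ring_bracket, mul_add, add_mul,
      Algebra.TensorProduct.tmul_mul_tmul, one_mul, mul_one, TensorProduct.sub_tmul,
      TensorProduct.tmul_sub]
    abel

/-- The comultiplication of `U(L)`: the algebra map with `Δ(x) = x ⊗ 1 + 1 ⊗ x` on `L`. -/
def comulHom : UniversalEnvelopingAlgebra K L →ₐ[K]
    UniversalEnvelopingAlgebra K L ⊗[K] UniversalEnvelopingAlgebra K L :=
  lift K (comulLie K)

/-- The counit of `U(L)`: the algebra map with `ε(x) = 0` on `L`. -/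
def counitHom : UniversalEnvelopingAlgebra K L →ₐ[K] K :=
  lift K 0

theorem comulHom_ι (x : L) :
    comulHom K (ι K x) = ι K x ⊗ₜ[K] 1 + 1 ⊗ₜ[K] ι K x :=
  lift_ι_apply K (comulLie K) x

theorem counitHom_ι (x : L) : counitHom K (ι K x) = 0 :=
  lift_ι_apply K (0 : L →ₗ⁅K⁆ K) x

instance instBialgebra : Bialgebra K (UniversalEnvelopingAlgebra K L) :=
  .ofAlgHom (comulHom K) (counitHom K)
    (algHom_ext_ι K fun x => by
      simp [comulHom_ι, -ι_apply, Algebra.TensorProduct.one_def, TensorProduct.add_tmul,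
        TensorProduct.tmul_add]
      abel)
    (algHom_ext_ι K fun x => by simp [comulHom_ι, counitHom_ι, -ι_apply])
    (algHom_ext_ι K fun x => by simp [comulHom_ι, counitHom_ι, -ι_apply])

/-- The elements of `L` are primitive in `U(L)`. -/
theorem comul_ι (x : L) :
    Coalgebra.comul (R := K) (ι K x) = ι K x ⊗ₜ[K] 1 + 1 ⊗ₜ[K] ι K x :=
  comulHom_ι K x

theorem counit_ι (x : L) : Coalgebra.counit (R := K) (ι K x) = 0 :=
  counitHom_ι K x

instance instIsCocomm : Coalgebra.IsCocomm K (UniversalEnvelopingAlgebra K L) where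
  comm_comp_comul := by
    have h : (Algebra.TensorProduct.comm K (UniversalEnvelopingAlgebra K L)
          (UniversalEnvelopingAlgebra K L)).toAlgHom.comp (Bialgebra.comulAlgHom K _) =
        Bialgebra.comulAlgHom K (UniversalEnvelopingAlgebra K L) :=
      algHom_ext_ι K fun x => by
        simp [comul_ι, -ι_apply]
        abel
    exact congr(($h).toLinearMap)

/-- The Lie algebra map `L → U(L)ᵐᵒᵖ`, `x ↦ -x`. -/
def antipodeLie : L →ₗ⁅K⁆ (UniversalEnvelopingAlgebra K L)ᵐᵒᵖ where
  toFun x := MulOpposite.op (-ι K x)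
  map_add' x y := by
    rw [map_add, neg_add, MulOpposite.op_add]
  map_smul' c x := by
    rw [map_smul, ← smul_neg, MulOpposite.op_smul, RingHom.id_apply]
  map_lie' {x y} := by
    simp only [LieHom.map_lie, LieRing.of_associative_ring_bracket, ← MulOpposite.op_mul,
      ← MulOpposite.op_sub, neg_mul_neg, neg_sub]

/-- The antipode of `U(L)`: the anti-homomorphism of algebras with `S(x) = -x` on `L`. -/
def antipodeLin : UniversalEnvelopingAlgebra K L →ₗ[K] UniversalEnvelopingAlgebra K L :=
  (MulOpposite.opLinearEquiv K).symm.toLinearMap ∘ₗ (lift K (antipodeLie K)).toLinearMap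

theorem antipodeLin_mul (a b : UniversalEnvelopingAlgebra K L) :
    antipodeLin K (a * b) = antipodeLin K b * antipodeLin K a := by
  simp [antipodeLin]

theorem antipodeLin_one :
    antipodeLin K (1 : UniversalEnvelopingAlgebra K L) = 1 := by
  simp [antipodeLin]

theorem antipodeLin_ι (x : L) : antipodeLin K (ι K x) = -ι K x := by
  have h := lift_ι_apply K (antipodeLie K) x
  simp only [antipodeLin, LinearMap.comp_apply, AlgHom.toLinearMap_apply, h]
  rfl

/-- Induction along left multiplication by elements of `L`. -/
theorem induction_left {P : UniversalEnvelopingAlgebra K L → Prop}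
    (one : P 1) (add : ∀ a b, P a → P b → P (a + b)) (smul : ∀ (c : K) a, P a → P (c • a))
    (ι_mul : ∀ (x : L) a, P a → P (ι K x * a)) (a : UniversalEnvelopingAlgebra K L) : P a := by
  let S : Subalgebra K (UniversalEnvelopingAlgebra K L) :=
    { carrier := {s | ∀ g, P g → P (s * g)}
      mul_mem' := fun {s t} hs ht g hg => by rw [mul_assoc]; exact hs _ (ht _ hg)
      add_mem' := fun {s t} hs ht g hg => by rw [add_mul]; exact add _ _ (hs g hg) (ht g hg)
      algebraMap_mem' := fun c g hg => by
        rw [← Algebra.smul_def]; exact smul c g hg }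
  let j : L →ₗ⁅K⁆ S :=
    { toFun := fun x => ⟨ι K x, fun g hg => ι_mul x g hg⟩
      map_add' := fun x y => Subtype.ext (map_add (ι K) x y)
      map_smul' := fun c x => Subtype.ext (map_smul (ι K) c x)
      map_lie' := fun {x y} => Subtype.ext (LieHom.map_lie (ι K) x y) }
  have h : S.val.comp (lift K j) = AlgHom.id K _ :=
    algHom_ext_ι K fun x => by
      rw [AlgHom.comp_apply, lift_ι_apply]; rfl
  have ha : S.val (lift K j a) = a := DFunLike.congr_fun h a
  have := (lift K j a).2 1 one
  rw [mul_one] at this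
  rw [← ha]
  exact this

theorem antipode_left (a : UniversalEnvelopingAlgebra K L) :
    LinearMap.mul' K _ ((antipodeLin K).rTensor _ (Coalgebra.comul (R := K) a)) =
      algebraMap K _ (Coalgebra.counit (R := K) a) := by
  induction a using induction_left K with
  | one => simp [Algebra.TensorProduct.one_def, antipodeLin_one]
  | add a b ha hb => simp only [map_add, ha, hb]
  | smul c a ha =>
    rw [map_smul, map_smul, map_smul, map_smul, ha, smul_eq_mul, map_mul, Algebra.smul_def]
  | ι_mul x a _ =>
    rw [Bialgebra.comul_mul, Bialgebra.counit_mul, comul_ι, counit_ι, zero_mul, map_zero]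
    generalize Coalgebra.comul (R := K) a = t
    induction t using TensorProduct.induction_on with
    | zero => simp only [mul_zero, map_zero]
    | add s t hs ht => simp only [mul_add, map_add, hs, ht, add_zero]
    | tmul b c =>
      simp only [add_mul, Algebra.TensorProduct.tmul_mul_tmul, one_mul, map_add,
        LinearMap.rTensor_tmul, LinearMap.mul'_apply, antipodeLin_mul, antipodeLin_ι,
        mul_neg, neg_mul, mul_assoc, neg_add_cancel]

theorem antipode_right (a : UniversalEnvelopingAlgebra K L) :
    LinearMap.mul' K _ ((antipodeLin K).lTensor _ (Coalgebra.comul (R := K) a)) =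
      algebraMap K _ (Coalgebra.counit (R := K) a) := by
  induction a using induction_left K with
  | one => simp [Algebra.TensorProduct.one_def, antipodeLin_one]
  | add a b ha hb => simp only [map_add, ha, hb]
  | smul c a ha =>
    rw [map_smul, map_smul, map_smul, map_smul, ha, smul_eq_mul, map_mul, Algebra.smul_def]
  | ι_mul x a ha =>
    rw [Bialgebra.comul_mul, Bialgebra.counit_mul, comul_ι, counit_ι, zero_mul, map_zero]
    have key : ∀ t : UniversalEnvelopingAlgebra K L ⊗[K] UniversalEnvelopingAlgebra K L,
        LinearMap.mul' K _ ((antipodeLin K).lTensor _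
          ((ι K x ⊗ₜ[K] 1 + 1 ⊗ₜ[K] ι K x) * t)) =
        ι K x * LinearMap.mul' K _ ((antipodeLin K).lTensor _ t) -
          LinearMap.mul' K _ ((antipodeLin K).lTensor _ t) * ι K x := by
      intro t
      induction t using TensorProduct.induction_on with
      | zero => simp only [mul_zero, zero_mul, map_zero, sub_zero]
      | add s t hs ht =>
        simp only [mul_add, add_mul, map_add] at hs ht ⊢
        rw [hs, ht]; abel
      | tmul b c =>
        simp only [add_mul, Algebra.TensorProduct.tmul_mul_tmul, one_mul, map_add,
          LinearMap.lTensor_tmul, LinearMap.mul'_apply, antipodeLin_mul, antipodeLin_ι,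
          mul_neg, mul_assoc, sub_eq_add_neg]
    rw [key, ha, Algebra.commutes, sub_self]

instance instHopfAlgebra : HopfAlgebra K (UniversalEnvelopingAlgebra K L) where
  antipode := antipodeLin K
  mul_antipode_rTensor_comul := LinearMap.ext (antipode_left K)
  mul_antipode_lTensor_comul := LinearMap.ext (antipode_right K)

/-- The morphism of Hopf algebras `U(f) : U(L) → U(L')` induced by a morphism of Lie algebras
`f : L → L'`; it sends `x ∈ L` to `f x`. -/
def map (f : L →ₗ⁅K⁆ L') :
    UniversalEnvelopingAlgebra K L →ₐc[K] UniversalEnvelopingAlgebra K L' :=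
  BialgHom.ofAlgHom (lift K ((ι K).comp f))
    (algHom_ext_ι K fun x => by
      rw [AlgHom.comp_apply, lift_ι_apply]
      exact (counit_ι K (f x)).trans (counit_ι K x).symm)
    (algHom_ext_ι K fun x => by
      simp only [AlgHom.comp_apply, lift_ι_apply, Bialgebra.comulAlgHom_apply, comul_ι, map_add,
        Algebra.TensorProduct.map_tmul, map_one, LieHom.comp_apply])

theorem map_ι (f : L →ₗ⁅K⁆ L') (x : L) : map K f (ι K x) = ι K (f x) :=
  lift_ι_apply K ((ι K).comp f) x

end UniversalEnvelopingAlgebra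

/-! ### The Hopf kernel -/

/-- The Hopf kernel of a morphism of Hopf algebras `p : H → B`, as a subset (a subalgebra) of `H`:
`HKer(p) = {h ∈ H | p(h₁) ⊗ h₂ = 1 ⊗ h}`. -/
def HKer {K H B : Type*} [Field K] [Ring H] [HopfAlgebra K H] [Ring B] [HopfAlgebra K B]
    (p : H →ₐc[K] B) : Subalgebra K H :=
  AlgHom.equalizer
    ((Algebra.TensorProduct.map (p : H →ₐ[K] B) (AlgHom.id K H)).comp
      (Bialgebra.comulAlgHom K H))
    (Algebra.TensorProduct.includeRight : H →ₐ[K] B ⊗[K] H)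

theorem mem_HKer {K H B : Type*} [Field K] [Ring H] [HopfAlgebra K H] [Ring B] [HopfAlgebra K B]
    (p : H →ₐc[K] B) (h : H) :
    h ∈ HKer p ↔
      TensorProduct.map (p : H →ₗ[K] B) (LinearMap.id : H →ₗ[K] H) (Coalgebra.comul (R := K) h) =
        (1 : B) ⊗ₜ[K] h :=
  Iff.rfl

/-! ### The category of cocommutative Hopf algebras -/

/-- The category of cocommutative Hopf `K`-algebras: the full subcategory of the category of Hopf
`K`-algebras on the objects with a cocommutative comultiplication. -/
abbrev CocommHopfAlgCat (K : Type u) [Field K] : Type (max u (v + 1)) :=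
  ObjectProperty.FullSubcategory
    (fun H : HopfAlgCat.{v} K => Coalgebra.IsCocomm K H)

namespace CocommHopfAlgCat

variable {K : Type u} [Field K]

/-- The zero morphism `A → B` is the composite `u_B ∘ ε_A` of the counit and the unit. -/
instance instHasZeroMorphisms : HasZeroMorphisms (CocommHopfAlgCat.{u, v} K) where
  zero A B := ⟨ObjectProperty.homMk
    (HopfAlgCat.ofHom ((Bialgebra.unitBialgHom K B.obj).comp (Bialgebra.counitBialgHom K A.obj)))⟩
  comp_zero {A B} f C := by
    apply ObjectProperty.hom_ext
    apply HopfAlgCat.hom_ext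
    apply BialgHom.ext
    intro x
    exact congrArg (algebraMap K C.obj)
      (CoalgHomClass.counit_comp_apply f.hom.toBialgHom x)
  zero_comp A {B C} g := by
    apply ObjectProperty.hom_ext
    apply HopfAlgCat.hom_ext
    apply BialgHom.ext
    intro x
    exact AlgHomClass.commutes g.hom.toBialgHom (Coalgebra.counit (R := K) x)

variable (K)

/-- The universal enveloping algebra `U(L)` as a cocommutative Hopf algebra. -/
def U (L : Type v) [LieRing L] [LieAlgebra K L] : CocommHopfAlgCat.{u, max u v} K where
  obj := HopfAlgCat.of K (UniversalEnvelopingAlgebra K L)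
  property := UniversalEnvelopingAlgebra.instIsCocomm K

/-- The morphism `U(f) : U(L) ⟶ U(L')` of cocommutative Hopf algebras. -/
def Umap {L L' : Type v} [LieRing L] [LieAlgebra K L] [LieRing L'] [LieAlgebra K L']
    (f : L →ₗ⁅K⁆ L') : U K L ⟶ U K L' :=
  ObjectProperty.homMk (HopfAlgCat.ofHom (UniversalEnvelopingAlgebra.map K f))

end CocommHopfAlgCat

end

/-! The core is a Poincaré–Birkhoff–Witt statement, `exists_symbol`: a linear map `p` from a Lie
algebra to a commutative algebra gives, for each `d`, a linear map on the enveloping algebra that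
kills words of length `< d` and multiplies the `p`-values of the letters of a word of length `d`. It
comes from an explicit action on `Sym(L)`. Left multiplication by `x` on `U(L)`, transported by
symmetrization, is the sum over `k` of `p ↦ (B_k / k!) ∑ ∂_{i₁} ⋯ ∂_{i_k} p · ⁅e_{i₁}, ⁅…, ⁅e_{i_k},
x⁆⁆⁆`. That this is a representation is checked directly, and reduces to an identity for the
coefficients of `z / (e^z - 1)` (`sum_bernCoeff`). A Laurent variable separates the orders `k`, so
that the leading part of a word is the product of its letters in `Sym(L)`.

For the Hopf kernel, let `Y` be the image of `U(ker f)` and let `z` lift a basis of `f(L)`. Modulo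
lower degree, every element is `∑ u_α z^α` with `u_α ∈ Y`. Applying the symbol of degree `d > 0` to
the first factor of `U(f)(h₁) ⊗ h₂` yields `∑ X^α ⊗ u_α`, but for `h` in the Hopf kernel it also
yields the symbol of `1`, which is zero. So the leading coefficients vanish, and descent on `d` ends
with `h ∈ Y`. Injectivity of `U(i)` is the same descent with scalar coefficients; both use
`mem_filt_of_map_eq_zero`.

For the universal property, a Hopf map killed by `U(f)` lands in the Hopf kernel by the counit
axiom, hence factors through the injective `U(i)`. -/

/-! ### An identity between Bernoulli numbers -/

noncomputable section

/-- The divided difference `((s + t) ^ k - s ^ k) / t`, as a polynomial expression in `s`, `t`. -/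
def powDivDiff {R : Type*} [Ring R] (s t : R) : ℕ → R
  | 0 => 0
  | k + 1 => s ^ k + (s + t) * powDivDiff s t k

theorem mul_powDivDiff {R : Type*} [CommRing R] (s t : R) (k : ℕ) :
    t * powDivDiff s t k = (s + t) ^ k - s ^ k := by
  induction k with
  | zero => simp [powDivDiff]
  | succ k ih => rw [powDivDiff, pow_succ, pow_succ]; linear_combination (s + t) * ih

theorem map_powDivDiff {R R' : Type*} [Ring R] [Ring R'] (φ : R →+* R') (s t : R) (k : ℕ) :
    φ (powDivDiff s t k) = powDivDiff (φ s) (φ t) k := by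
  induction k with
  | zero => simp [powDivDiff]
  | succ k ih => simp [powDivDiff, ih]

open PowerSeries in
theorem rescale_bernoulli_mul {A : Type*} [CommRing A] [Algebra ℚ A] (s : A) :
    rescale s (bernoulliPowerSeries A) * (rescale s (exp A) - 1) = C s * X := by
  have h := congrArg (rescale s) (bernoulliPowerSeries_mul_exp_sub_one A)
  rwa [map_mul, map_sub, map_one, rescale_X] at h

open PowerSeries in
/-- The functional equation of `z / (e ^ z - 1)`. -/
theorem bernoulli_functional_equation {A : Type*} [CommRing A] [IsDomain A] [Algebra ℚ A]
    {s t : A} (hs : s ≠ 0) (ht : t ≠ 0) (hst : s + t ≠ 0) :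
    C s * rescale t (bernoulliPowerSeries A) *
        (rescale (s + t) (bernoulliPowerSeries A) - rescale s (bernoulliPowerSeries A)) +
      C t * rescale s (bernoulliPowerSeries A) *
        (rescale (s + t) (bernoulliPowerSeries A) - rescale t (bernoulliPowerSeries A)) =
      - (C s * C t * X * rescale (s + t) (bernoulliPowerSeries A)) := by
  have key : ∀ {r : A}, r ≠ 0 → rescale r (exp A) - 1 ≠ 0 := fun {r} hr h => by
    have := rescale_bernoulli_mul r
    rw [h, mul_zero] at this
    have := congrArg (coeff 1) this
    simp at this
    exact hr this.symm
  have ha := rescale_bernoulli_mul s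
  have hb := rescale_bernoulli_mul t
  have hc := rescale_bernoulli_mul (s + t)
  have ka := key hs
  have kb := key ht
  have kc := key hst
  rw [← exp_mul_exp_eq_exp_add] at hc kc
  rw [map_add] at hc
  generalize rescale s (bernoulliPowerSeries A) = Bs at *
  generalize rescale t (bernoulliPowerSeries A) = Bt at *
  generalize rescale (s + t) (bernoulliPowerSeries A) = Bu at *
  generalize rescale s (exp A) = a at *
  generalize rescale t (exp A) = b at *
  generalize C s = s' at *
  generalize C t = t' at *
  -- Multiplying by the three nonzero denominators turns each Bernoulli series into a linear
  -- monomial, leaving a polynomial identity in `a` and `b`.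
  apply mul_right_cancel₀ (mul_ne_zero (mul_ne_zero ka kb) kc)
  have e : (s' * Bt * (Bu - Bs) + t' * Bs * (Bu - Bt)) * ((a - 1) * (b - 1) * (a * b - 1)) =
    s' * (Bt * (b - 1)) * ((Bu * (a * b - 1)) * (a - 1) - (Bs * (a - 1)) * (a * b - 1)) +
    t' * (Bs * (a - 1)) * ((Bu * (a * b - 1)) * (b - 1) - (Bt * (b - 1)) * (a * b - 1)) := by
    ring
  have e' : -(s' * t' * X * Bu) * ((a - 1) * (b - 1) * (a * b - 1)) =
    -(s' * t' * X * (Bu * (a * b - 1)) * ((a - 1) * (b - 1))) := by ring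
  rw [e, e', ha, hb, hc]
  ring

/-- The coefficients of `z / (e ^ z - 1)`. -/
def bernCoeff (K : Type*) [Field K] [CharZero K] (n : ℕ) : K :=
  algebraMap ℚ K (bernoulli n / n.factorial)

theorem bernCoeff_zero (K : Type*) [Field K] [CharZero K] : bernCoeff K 0 = 1 := by
  simp [bernCoeff]

open PowerSeries in
theorem coeff_rescale_bernoulli {K A : Type*} [Field K] [CharZero K] [CommRing A] [Algebra ℚ A]
    [Algebra K A] (s : A) (n : ℕ) :
    coeff n (rescale s (bernoulliPowerSeries A)) = algebraMap K A (bernCoeff K n) * s ^ n := by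
  rw [coeff_rescale, bernoulliPowerSeries, coeff_mk, bernCoeff, mul_comm]
  congr 1
  exact DFunLike.congr_fun (Subsingleton.elim (algebraMap ℚ A)
    ((algebraMap K A).comp (algebraMap ℚ K))) _

-- Coefficient of `X ^ (n + 1)` in the functional equation, divided by `s * t`. The shift from `n +
-- 1` to `n` is the factor `X` on the right-hand side there.
open PowerSeries Finset in
theorem sum_bernCoeff_domain (K : Type*) {A : Type*} [Field K] [CharZero K] [CommRing A]
    [IsDomain A] [Algebra ℚ A] [Algebra K A] {s t : A} (hs : s ≠ 0) (ht : t ≠ 0) (hst : s + t ≠ 0)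
    (n : ℕ) :
    ∑ p ∈ antidiagonal (n + 1), algebraMap K A (bernCoeff K p.1 * bernCoeff K p.2) *
      (powDivDiff s t p.1 * t ^ p.2 + powDivDiff t s p.2 * s ^ p.1) =
      - (algebraMap K A (bernCoeff K n) * (s + t) ^ n) := by
  have h := congrArg (coeff (n + 1)) (bernoulli_functional_equation hs ht hst)
  rw [map_add, map_neg] at h
  rw [mul_assoc (C s), mul_assoc (C t), mul_assoc (C s), mul_assoc (C s), coeff_C_mul,
    coeff_C_mul, coeff_C_mul, mul_assoc (C t), coeff_C_mul, mul_comm X, coeff_succ_mul_X,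
    mul_comm (rescale t _), coeff_mul, coeff_mul] at h
  simp only [map_sub, coeff_rescale_bernoulli (K := K)] at h
  apply mul_left_cancel₀ (mul_ne_zero hs ht)
  refine Eq.trans ?_ (h.trans (by ring))
  rw [Finset.mul_sum, Finset.mul_sum, Finset.mul_sum, ← Finset.sum_add_distrib]
  refine Finset.sum_congr rfl fun p _ => ?_
  have h1 := mul_powDivDiff s t p.1
  have h2 := mul_powDivDiff t s p.2
  rw [add_comm t s] at h2
  rw [map_mul]
  linear_combination (s * algebraMap K A (bernCoeff K p.1) * algebraMap K A (bernCoeff K p.2) *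
    t ^ p.2) * h1 + (t * algebraMap K A (bernCoeff K p.1) * algebraMap K A (bernCoeff K p.2) *
    s ^ p.1) * h2

-- Both sides are polynomials in `s` and `t`, so the identity specializes from a polynomial ring,
-- where dividing by `s * t` is legitimate, to any commuting pair. The pair of interest consists of
-- two operators.
open Finset in
theorem sum_bernCoeff (K : Type*) {A : Type*} [Field K] [CharZero K] [Ring A] [Algebra K A]
    {s t : A} (hst : s * t = t * s) (n : ℕ) :
    ∑ p ∈ antidiagonal (n + 1), (bernCoeff K p.1 * bernCoeff K p.2) •
      (powDivDiff s t p.1 * t ^ p.2 + powDivDiff t s p.2 * s ^ p.1) =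
      - (bernCoeff K n • (s + t) ^ n) := by
  let C := Algebra.adjoin K ({s, t} : Set A)
  have : IsMulCommutative C := Algebra.isMulCommutative_adjoin K (by
    rintro a (rfl | rfl) b (rfl | rfl) <;> simp [hst])
  let _ : CommRing C := { C.toRing with mul_comm := this.is_comm.comm }
  let s' : C := ⟨s, Algebra.subset_adjoin (by simp)⟩
  let t' : C := ⟨t, Algebra.subset_adjoin (by simp)⟩
  have h := sum_bernCoeff_domain K (A := MvPolynomial (Fin 2) K)
    (s := MvPolynomial.X 0) (t := MvPolynomial.X 1) (MvPolynomial.X_ne_zero _)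
    (MvPolynomial.X_ne_zero _) (fun h => by
      have := congrArg (MvPolynomial.coeff (Finsupp.single 0 1)) h
      simp [MvPolynomial.coeff_X, Finsupp.single_eq_single_iff] at this) n
  let φ : MvPolynomial (Fin 2) K →ₐ[K] A := C.val.comp (MvPolynomial.aeval ![s', t'])
  have hs : φ (MvPolynomial.X 0) = s := by simp [φ, s']
  have ht : φ (MvPolynomial.X 1) = t := by simp [φ, t']
  simp only [← Algebra.smul_def] at h
  have h' := congrArg φ h
  have hd : ∀ a b k, φ (powDivDiff a b k) = powDivDiff (φ a) (φ b) k :=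
    fun a b k => map_powDivDiff φ.toRingHom a b k
  simpa only [map_sum, map_mul, map_neg, map_add, map_pow, hd, hs, ht, map_smul] using h'

end

/-! ### Differential operators on a symmetric algebra with coefficients in endomorphisms -/

noncomputable section

namespace PolyOp

open MvPolynomial Module

/-! ### The symmetric algebra of a vector space and operators `∑ ∂ᵢ ⊗ Q(eᵢ)` -/

section Linear

variable {K L I M M' : Type*} [Field K] [AddCommGroup L] [Module K L] (b : Basis I K L)
  [AddCommGroup M] [Module K M] [AddCommGroup M'] [Module K M']

/-- The embedding of a vector space with a basis into its symmetric algebra. -/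
def lam : L →ₗ[K] MvPolynomial I K := b.constr K X

theorem lam_basis (i : I) : lam b (b i) = X i := b.constr_basis K _ i

/-- The universal derivation of the symmetric algebra. -/
def diff : Derivation K (MvPolynomial I K) (MvPolynomial I K ⊗[K] L) :=
  mkDerivation K fun i => 1 ⊗ₜ b i

theorem diff_lam (x : L) : diff b (lam b x) = 1 ⊗ₜ x := by
  have : (diff b).toLinearMap ∘ₗ lam b = TensorProduct.mk K (MvPolynomial I K) L 1 :=
    b.ext fun i => by
      simp [lam_basis, diff, mkDerivation_X]
  exact DFunLike.congr_fun this x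

/-- The operator `∑ i, ∂ᵢ ⊗ Q(eᵢ)`. -/
def op (Q : L →ₗ[K] Module.End K M) : Module.End K (MvPolynomial I K ⊗[K] M) :=
  (TensorProduct.lift Q).lTensor (MvPolynomial I K) ∘ₗ
    (TensorProduct.assoc K (MvPolynomial I K) L M).toLinearMap ∘ₗ
      (diff b).toLinearMap.rTensor M

theorem op_one_tmul (Q : L →ₗ[K] Module.End K M) (m : M) : op b Q (1 ⊗ₜ m) = 0 := by
  simp [op]

theorem op_add (Q Q' : L →ₗ[K] Module.End K M) : op b (Q + Q') = op b Q + op b Q' := by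
  have : TensorProduct.lift (Q + Q') = TensorProduct.lift Q + TensorProduct.lift Q' :=
    TensorProduct.ext' fun x y => by simp
  rw [op, this, LinearMap.lTensor_add, LinearMap.add_comp]
  rfl

theorem op_mul_lam_tmul (Q : L →ₗ[K] Module.End K M) (p : MvPolynomial I K) (x : L) (m : M) :
    op b Q ((p * lam b x) ⊗ₜ m) = lam b x • op b Q (p ⊗ₜ m) + p ⊗ₜ Q x m := by
  have key : ∀ (q : MvPolynomial I K) (w : MvPolynomial I K ⊗[K] L),
      (TensorProduct.lift Q).lTensor (MvPolynomial I K)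
        (TensorProduct.assoc K (MvPolynomial I K) L M ((q • w) ⊗ₜ m)) =
      q • (TensorProduct.lift Q).lTensor (MvPolynomial I K)
        (TensorProduct.assoc K (MvPolynomial I K) L M (w ⊗ₜ m)) := by
    intro q w
    induction w using TensorProduct.induction_on with
    | zero => simp
    | add v w hv hw => simp only [smul_add, TensorProduct.add_tmul, map_add, hv, hw]
    | tmul r y => simp [TensorProduct.smul_tmul']
  simp only [op, LinearMap.comp_apply, LinearMap.rTensor_tmul, LinearEquiv.coe_coe,
    Derivation.coeFn_coe, Derivation.leibniz, diff_lam, TensorProduct.add_tmul, map_add, key]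
  simp [TensorProduct.smul_tmul', add_comm]

/-- Leibniz rule: the commutator of `op b Q` with multiplication by the linear form `lam b x` is `id
⊗ Q x`. -/
theorem op_lam_smul (Q : L →ₗ[K] Module.End K M) (x : L) (w : MvPolynomial I K ⊗[K] M) :
    op b Q (lam b x • w) = lam b x • op b Q w + (Q x).lTensor (MvPolynomial I K) w := by
  induction w using TensorProduct.induction_on with
  | zero => simp
  | add v w hv hw => simp only [smul_add, map_add, hv, hw]; abel
  | tmul p m =>
    rw [TensorProduct.smul_tmul', smul_eq_mul, mul_comm, op_mul_lam_tmul, LinearMap.lTensor_tmul]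

theorem hom_ext {N : Type*} [AddCommGroup N] [Module K N]
    {F G : MvPolynomial I K ⊗[K] M →ₗ[K] N} (h1 : ∀ m, F (1 ⊗ₜ m) = G (1 ⊗ₜ m))
    (h2 : ∀ (p : MvPolynomial I K) (x : L), (∀ m, F (p ⊗ₜ m) = G (p ⊗ₜ m)) →
      ∀ m, F ((p * lam b x) ⊗ₜ m) = G ((p * lam b x) ⊗ₜ m)) : F = G := by
  refine TensorProduct.ext' fun p => ?_
  induction p using MvPolynomial.induction_on with
  | C a =>
    intro m
    rw [← mul_one (C a), ← smul_eq_C_mul, ← TensorProduct.smul_tmul', map_smul, map_smul, h1]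
  | add p q hp hq => intro m; rw [TensorProduct.add_tmul, map_add, map_add, hp, hq]
  | mul_X p i hp => intro m; rw [← lam_basis b]; exact h2 p _ hp m

theorem lTensor_smul_apply (φ : M →ₗ[K] M') (q : MvPolynomial I K)
    (w : MvPolynomial I K ⊗[K] M) :
    φ.lTensor (MvPolynomial I K) (q • w) = q • φ.lTensor (MvPolynomial I K) w :=
  (TensorProduct.AlgebraTensorModule.lTensor (MvPolynomial I K) (MvPolynomial I K) φ).map_smul q w

/-- Naturality in the coefficient module. It carries `op` along the maps `x ⊗ -` and `- ⊗ z`, the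
exchange of factors and the bracket. -/
theorem lTensor_op {Q : L →ₗ[K] Module.End K M} {Q' : L →ₗ[K] Module.End K M'}
    (φ : M →ₗ[K] M') (h : ∀ x m, φ (Q x m) = Q' x (φ m)) (w : MvPolynomial I K ⊗[K] M) :
    φ.lTensor (MvPolynomial I K) (op b Q w) = op b Q' (φ.lTensor (MvPolynomial I K) w) := by
  have : φ.lTensor (MvPolynomial I K) ∘ₗ op b Q = op b Q' ∘ₗ φ.lTensor (MvPolynomial I K) := by
    refine hom_ext b (fun m => by simp [op_one_tmul]) fun p x hp m => ?_
    have hp := hp m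
    simp only [LinearMap.comp_apply, LinearMap.lTensor_tmul] at hp ⊢
    rw [op_mul_lam_tmul, op_mul_lam_tmul, map_add, lTensor_smul_apply, hp,
      LinearMap.lTensor_tmul, h]
  exact DFunLike.congr_fun this w

theorem lTensor_op_pow {Q : L →ₗ[K] Module.End K M} {Q' : L →ₗ[K] Module.End K M'}
    (φ : M →ₗ[K] M') (h : ∀ x m, φ (Q x m) = Q' x (φ m)) (k : ℕ)
    (w : MvPolynomial I K ⊗[K] M) :
    φ.lTensor (MvPolynomial I K) ((op b Q ^ k) w) =
      (op b Q' ^ k) (φ.lTensor (MvPolynomial I K) w) := by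
  induction k with
  | zero => rfl
  | succ k ih => rw [pow_succ', pow_succ', Module.End.mul_apply, lTensor_op b φ h, ih]; rfl

theorem op_comm {Q Q' : L →ₗ[K] Module.End K M} (h : ∀ x y m, Q x (Q' y m) = Q' y (Q x m)) :
    op b Q * op b Q' = op b Q' * op b Q := by
  refine hom_ext b (fun m => by simp [op_one_tmul]) fun p x hp m => ?_
  have hp := hp m
  simp only [Module.End.mul_apply] at hp ⊢
  simp only [op_mul_lam_tmul, map_add, op_lam_smul, hp]
  rw [lTensor_op b (Q x) fun y m => h x y m, lTensor_op b (Q' x) fun y m => (h y x m).symm]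
  simp only [LinearMap.lTensor_tmul]
  abel

/-- Multiplication `p ⊗ x ↦ p x`. -/
def mulLam : MvPolynomial I K ⊗[K] L →ₗ[K] MvPolynomial I K :=
  LinearMap.mul' K (MvPolynomial I K) ∘ₗ (lam b).lTensor (MvPolynomial I K)

theorem mulLam_tmul (p : MvPolynomial I K) (x : L) : mulLam b (p ⊗ₜ x) = p * lam b x := by
  simp [mulLam]

/-- Partial multiplication `p ⊗ (x ⊗ z) ↦ p z ⊗ x`. -/
def mulRight : MvPolynomial I K ⊗[K] (L ⊗[K] L) →ₗ[K] MvPolynomial I K ⊗[K] L :=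
  (mulLam b).rTensor L ∘ₗ (TensorProduct.assoc K (MvPolynomial I K) L L).symm.toLinearMap ∘ₗ
    (TensorProduct.comm K L L).toLinearMap.lTensor (MvPolynomial I K)

theorem mulRight_tmul (p : MvPolynomial I K) (x z : L) :
    mulRight b (p ⊗ₜ (x ⊗ₜ z)) = (p * lam b z) ⊗ₜ x := by
  simp [mulRight, mulLam_tmul]

theorem mulRight_lTensor_flip_mk (z : L) (w : MvPolynomial I K ⊗[K] L) :
    mulRight b (((TensorProduct.mk K L L).flip z).lTensor (MvPolynomial I K) w) =
      lam b z • w := by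
  induction w using TensorProduct.induction_on with
  | zero => simp
  | add v w hv hw => simp only [smul_add, map_add, hv, hw]
  | tmul p m => simp [mulRight_tmul, TensorProduct.smul_tmul', mul_comm]

theorem mulRight_lTensor_mk (x : L) (w : MvPolynomial I K ⊗[K] L) :
    mulRight b ((TensorProduct.mk K L L x).lTensor (MvPolynomial I K) w) =
      mulLam b w ⊗ₜ x := by
  induction w using TensorProduct.induction_on with
  | zero => simp
  | add v w hv hw => simp only [TensorProduct.add_tmul, map_add, hv, hw]
  | tmul p m => simp [mulRight_tmul, mulLam_tmul]

/-- The exchange of the last two factors. -/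
def swap : MvPolynomial I K ⊗[K] (L ⊗[K] L) →ₗ[K] MvPolynomial I K ⊗[K] (L ⊗[K] L) :=
  (TensorProduct.comm K L L).toLinearMap.lTensor (MvPolynomial I K)

theorem mulLam_mulRight_swap (w : MvPolynomial I K ⊗[K] (L ⊗[K] L)) :
    mulLam b (mulRight b (swap w)) = mulLam b (mulRight b w) := by
  have : mulLam b ∘ₗ mulRight b ∘ₗ swap = mulLam b ∘ₗ mulRight b := by
    refine TensorProduct.ext_threefold' fun p x y => ?_
    simp [swap, mulRight_tmul, mulLam_tmul, mul_right_comm]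
  exact DFunLike.congr_fun this w

end Linear

/-! ### The adjoint operators on `Sym(L) ⊗ L` and `Sym(L) ⊗ (L ⊗ L)` -/

section Lie

variable {K L I : Type*} [Field K] [LieRing L] [LieAlgebra K L] (b : Basis I K L)

/-- The adjoint action as a linear map. -/
def adj : L →ₗ[K] Module.End K L := (LieModule.toEnd K L L : L →ₗ[K] Module.End K L)

theorem adj_apply (x y : L) : adj (K := K) x y = ⁅x, y⁆ := rfl

/-- The adjoint action on the first factor of `L ⊗ L`. -/
def adjL : L →ₗ[K] Module.End K (L ⊗[K] L) := LinearMap.rTensorHom L ∘ₗ adj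

/-- The adjoint action on the second factor of `L ⊗ L`. -/
def adjR : L →ₗ[K] Module.End K (L ⊗[K] L) := LinearMap.lTensorHom L ∘ₗ adj

theorem adjL_tmul (x y z : L) : adjL (K := K) x (y ⊗ₜ z) = ⁅x, y⁆ ⊗ₜ z := rfl

theorem adjR_tmul (x y z : L) : adjR (K := K) x (y ⊗ₜ z) = y ⊗ₜ ⁅x, z⁆ := rfl

/-- The bracket `p ⊗ (x ⊗ y) ↦ p ⊗ ⁅x, y⁆`. -/
def brk : MvPolynomial I K ⊗[K] (L ⊗[K] L) →ₗ[K] MvPolynomial I K ⊗[K] L :=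
  (LieModule.toModuleHom K L L : L ⊗[K] L →ₗ[K] L).lTensor (MvPolynomial I K)

theorem brk_tmul (p : MvPolynomial I K) (x y : L) :
    brk (p ⊗ₜ (x ⊗ₜ y)) = p ⊗ₜ[K] ⁅x, y⁆ := by
  simp [brk]

theorem brk_swap (w : MvPolynomial I K ⊗[K] (L ⊗[K] L)) : brk (swap w) = - brk w := by
  have : (brk ∘ₗ swap : MvPolynomial I K ⊗[K] (L ⊗[K] L) →ₗ[K] _) = - brk := by
    refine TensorProduct.ext_threefold' fun p x y => ?_
    simp [swap, brk_tmul, ← TensorProduct.tmul_neg]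
  exact DFunLike.congr_fun this w

theorem adjL_adjR_comm : op b (adjL (K := K)) * op b adjR = op b adjR * op b adjL := by
  refine op_comm b fun x y m => ?_
  induction m using TensorProduct.induction_on with
  | zero => simp
  | add v w hv hw => simp only [map_add, hv, hw]
  | tmul u v => simp only [adjL_tmul, adjR_tmul]

/-- By the Jacobi identity the bracket `L ⊗ L → L` is equivariant when `L` acts on the source
through both factors. -/
theorem op_adj_pow_brk (k : ℕ) (w : MvPolynomial I K ⊗[K] (L ⊗[K] L)) :
    (op b adj ^ k) (brk w) = brk (((op b adjL + op b adjR) ^ k) w) := by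
  rw [← op_add, brk, lTensor_op_pow b]
  intro x m
  induction m using TensorProduct.induction_on with
  | zero => simp
  | add v w hv hw => simp only [map_add, hv, hw]
  | tmul u v =>
    simp [adjL_tmul, adjR_tmul, adj_apply]

/-- On `p z ⊗ x` the derivative hits either `p` or `z`; the second case produces `p ⊗ ⁅z, x⁆`,
whence the sign. -/
theorem op_adj_mulRight (w : MvPolynomial I K ⊗[K] (L ⊗[K] L)) :
    op b adj (mulRight b w) = mulRight b (op b adjL w) - brk w := by
  have : op b adj ∘ₗ mulRight b = mulRight b ∘ₗ op b adjL - brk := by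
    refine TensorProduct.ext_threefold' fun p x z => ?_
    have h := lTensor_op b (Q := adj) (Q' := adjL) ((TensorProduct.mk K L L).flip z)
      (fun _ _ => rfl) (p ⊗ₜ x)
    rw [LinearMap.lTensor_tmul, LinearMap.flip_apply, TensorProduct.mk_apply] at h
    simp only [LinearMap.comp_apply, LinearMap.sub_apply, mulRight_tmul, brk_tmul]
    rw [← h, mulRight_lTensor_flip_mk, op_mul_lam_tmul, adj_apply, ← lie_skew,
      TensorProduct.tmul_neg, sub_eq_add_neg]
  exact DFunLike.congr_fun this w

/-- Each passage across `mulRight` leaves a bracket term, on which the remaining powers act as `op b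
adjL + op b adjR`. This accumulation is the recursion defining `powDivDiff`. -/
theorem op_adj_pow_mulRight (k : ℕ) (w : MvPolynomial I K ⊗[K] (L ⊗[K] L)) :
    (op b adj ^ k) (mulRight b w) =
      mulRight b ((op b adjL ^ k) w) - brk (powDivDiff (op b adjL) (op b adjR) k w) := by
  induction k with
  | zero => simp [powDivDiff]
  | succ k ih =>
    have h := op_adj_pow_brk b 1 (powDivDiff (op b adjL) (op b adjR) k w)
    rw [pow_one, pow_one] at h
    rw [pow_succ', Module.End.mul_apply, ih, map_sub, op_adj_mulRight, h, powDivDiff, pow_succ']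
    simp only [LinearMap.add_apply, map_add, Module.End.mul_apply]
    abel

theorem swap_adjL_pow (k : ℕ) (w : MvPolynomial I K ⊗[K] (L ⊗[K] L)) :
    swap ((op b adjL ^ k) w) = (op b adjR ^ k) (swap w) := by
  refine lTensor_op_pow b _ (fun x m => ?_) k w
  induction m using TensorProduct.induction_on with
  | zero => simp
  | add v w hv hw => simp only [map_add, hv, hw]
  | tmul u v => simp [adjL_tmul, adjR_tmul]

theorem swap_swap (w : MvPolynomial I K ⊗[K] (L ⊗[K] L)) : swap (swap w) = w := by
  have : (swap ∘ₗ swap : MvPolynomial I K ⊗[K] (L ⊗[K] L) →ₗ[K] _) = LinearMap.id := by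
    refine TensorProduct.ext_threefold' fun p x y => ?_
    simp [swap]
  exact DFunLike.congr_fun this w

theorem swap_adjR_pow (k : ℕ) (w : MvPolynomial I K ⊗[K] (L ⊗[K] L)) :
    swap ((op b adjR ^ k) w) = (op b adjL ^ k) (swap w) := by
  rw [← swap_swap ((op b adjL ^ k) (swap w)), swap_adjL_pow, swap_swap]

theorem swap_powDivDiff (k : ℕ) (w : MvPolynomial I K ⊗[K] (L ⊗[K] L)) :
    swap (powDivDiff (op b adjL) (op b adjR) k w) =
      powDivDiff (op b adjR) (op b adjL) k (swap w) := by
  induction k with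
  | zero => simp [powDivDiff]
  | succ k ih =>
    have h1 := swap_adjL_pow b 1
    have h2 := swap_adjR_pow b 1
    simp only [pow_one] at h1 h2
    simp only [powDivDiff, LinearMap.add_apply, Module.End.mul_apply, map_add, swap_adjL_pow, h1,
      h2, ih]

/-! ### The action of `L` on `Sym(L)` and its commutation relations -/

variable [CharZero K]

/-- The homogeneous components of the action of `L` on its symmetric algebra. -/
def rho (k : ℕ) : L →ₗ[K] Module.End K (MvPolynomial I K) :=
  bernCoeff K k • (LinearMap.llcomp K _ _ _ (mulLam b ∘ₗ op b adj ^ k) ∘ₗ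
    (TensorProduct.mk K (MvPolynomial I K) L).flip)

theorem rho_apply (k : ℕ) (x : L) (p : MvPolynomial I K) :
    rho b k x p = bernCoeff K k • mulLam b ((op b adj ^ k) (p ⊗ₜ x)) := rfl

theorem rho_zero_apply (x : L) (p : MvPolynomial I K) : rho b 0 x p = p * lam b x := by
  simp [rho_apply, bernCoeff_zero, mulLam_tmul]

/-- While `rho b l y` acts, `x` is an inert first factor of `L ⊗ L`, so the inner powers become
powers of `op b adjR`; the outer ones are then moved across `mulRight`. -/
theorem rho_rho (k l : ℕ) (x y : L) (p : MvPolynomial I K) :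
    rho b k x (rho b l y p) = (bernCoeff K k * bernCoeff K l) •
      (mulLam b (mulRight b ((op b adjL ^ k * op b adjR ^ l) (p ⊗ₜ (x ⊗ₜ y)))) -
        mulLam b (brk ((powDivDiff (op b adjL) (op b adjR) k * op b adjR ^ l)
          (p ⊗ₜ (x ⊗ₜ y))))) := by
  have h := lTensor_op_pow b (Q := adj) (Q' := adjR) (TensorProduct.mk K L L x)
      (fun _ _ => rfl) l (p ⊗ₜ y)
  rw [LinearMap.lTensor_tmul, TensorProduct.mk_apply] at h
  rw [rho_apply b l, map_smul, rho_apply, smul_smul, mul_comm (bernCoeff K l),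
    ← mulRight_lTensor_mk, h, op_adj_pow_mulRight, map_sub]
  rfl

/-- Under the exchange of `x` and `y`, the terms in which both letters are multiplied into the
polynomial agree and cancel. The bracket terms change sign and add up. -/
theorem rho_commutator (k l : ℕ) (x y : L) (p : MvPolynomial I K) :
    rho b k x (rho b l y p) - rho b l y (rho b k x p) =
      - mulLam b (brk (((bernCoeff K k * bernCoeff K l) •
        (powDivDiff (op b adjL) (op b adjR) k * op b adjR ^ l +
          powDivDiff (op b adjR) (op b adjL) l * op b adjL ^ k)) (p ⊗ₜ (x ⊗ₜ y)))) := by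
  have hs : (p ⊗ₜ[K] (y ⊗ₜ[K] x) : MvPolynomial I K ⊗[K] (L ⊗[K] L)) = swap (p ⊗ₜ (x ⊗ₜ y)) := by
    simp [swap]
  have hc : op b (adjL (K := K) (L := L)) ^ k * op b adjR ^ l = op b adjR ^ l * op b adjL ^ k :=
    Commute.pow_pow (adjL_adjR_comm b) k l
  rw [rho_rho, rho_rho, hs, mul_comm (bernCoeff K l), ← smul_sub, LinearMap.smul_apply, map_smul,
    map_smul, ← smul_neg, hc]
  congr 1
  have h1 : mulLam b (mulRight b ((op b adjL ^ l * op b adjR ^ k) (swap (p ⊗ₜ (x ⊗ₜ y))))) =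
      mulLam b (mulRight b ((op b adjR ^ l * op b adjL ^ k) (p ⊗ₜ (x ⊗ₜ y)))) := by
    rw [← mulLam_mulRight_swap, Module.End.mul_apply, swap_adjL_pow, swap_adjR_pow, swap_swap]
    rfl
  have h2 : brk ((powDivDiff (op b adjL) (op b adjR) l * op b adjR ^ k)
      (swap (p ⊗ₜ (x ⊗ₜ y)))) =
      - brk ((powDivDiff (op b adjR) (op b adjL) l * op b adjL ^ k) (p ⊗ₜ (x ⊗ₜ y))) := by
    rw [← brk_swap, Module.End.mul_apply, Module.End.mul_apply,
      ← swap_swap ((powDivDiff (op b adjL) (op b adjR) l) _), swap_powDivDiff, swap_adjR_pow, swap_swap]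
  rw [h1, h2, LinearMap.add_apply, map_add, map_add, map_neg]
  abel

-- This is `sum_bernCoeff` for the commuting operators `op b adjL` and `op b adjR`; their sum
-- becomes `op b adj` after the bracket.
open Finset in
theorem sum_rho_commutator (n : ℕ) (x y : L) :
    ∑ q ∈ antidiagonal (n + 1), (rho b q.1 x * rho b q.2 y - rho b q.2 y * rho b q.1 x) =
      rho b n ⁅x, y⁆ := by
  refine LinearMap.ext fun p => ?_
  simp only [LinearMap.sum_apply, LinearMap.sub_apply, Module.End.mul_apply, rho_commutator,
    sum_neg_distrib]
  rw [← map_sum, ← map_sum, ← LinearMap.sum_apply, sum_bernCoeff K (adjL_adjR_comm b),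
    LinearMap.neg_apply, map_neg, map_neg, neg_neg, LinearMap.smul_apply, map_smul, map_smul,
    ← op_adj_pow_brk, brk_tmul, rho_apply]

theorem rho_zero_comm (x y : L) : rho b 0 x * rho b 0 y = rho b 0 y * rho b 0 x := by
  refine LinearMap.ext fun p => ?_
  simp only [Module.End.mul_apply, rho_zero_apply]
  ring

end Lie

end PolyOp

end

/-! ### The symbol of an element of a universal enveloping algebra -/

noncomputable section

namespace PolyOp

open MvPolynomial Module

attribute [local instance 100] LieRing.ofAssociativeRing

theorem single_one_commute {R : Type*} [Ring R] (n : ℤ) (z : HahnSeries ℤ R) :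
    Commute (HahnSeries.single n (1 : R)) z :=
  HahnSeries.ext (funext fun a => by
    rw [HahnSeries.coeff_single_mul, HahnSeries.coeff_mul_single, one_mul, mul_one])

theorem coeff_ofPowerSeries_of_neg {R : Type*} [Ring R] (q : PowerSeries R) {n : ℤ} (hn : n < 0) :
    (HahnSeries.ofPowerSeries ℤ R q).coeff n = 0 := by
  rw [HahnSeries.ofPowerSeries_apply]
  refine HahnSeries.embDomain_of_notMem_range ?_
  rintro ⟨m, rfl⟩
  exact absurd hn (by simp)

/-- Used with `s` the Laurent variable and `e` its inverse: one pole per operator converts the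
relation with an extra factor `s` into a true bracket. -/
theorem mul_eq_lie_of_commute {R : Type*} [Ring R] {e s u v w : R} (he : ∀ z, Commute e z)
    (hes : e * s = 1) (h : u * v - v * u = s * w) : e * w = ⁅e * u, e * v⁆ := by
  have h1 : e * u * (e * v) = e * (e * (u * v)) := by
    rw [mul_assoc, ← mul_assoc u, ← (he u).eq, mul_assoc e u]
  have h2 : e * v * (e * u) = e * (e * (v * u)) := by
    rw [mul_assoc, ← mul_assoc v, ← (he v).eq, mul_assoc e v]
  rw [LieRing.of_associative_ring_bracket, h1, h2, ← mul_sub, ← mul_sub, h, ← mul_assoc e _ w,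
    hes, one_mul]

theorem mul_mul_mul_of_commute {R : Type*} [Ring R] {e f u v : R} (hf : ∀ z, Commute f z) :
    e * u * (f * v) = e * f * (u * v) := by
  rw [mul_assoc, ← mul_assoc u, ← (hf u).eq, mul_assoc f, mul_assoc e]

variable {K L I : Type*} [Field K] [CharZero K] [LieRing L] [LieAlgebra K L] (b : Basis I K L)

/-- The generating series of the operators `rho`. -/
def rhoSeries : L →ₗ[K] PowerSeries (Module.End K (MvPolynomial I K)) where
  toFun x := PowerSeries.mk fun k => rho b k x
  map_add' x y := by ext1 n; simp
  map_smul' c x := by ext1 n; simp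

theorem rhoSeries_commutator (x y : L) :
    rhoSeries b x * rhoSeries b y - rhoSeries b y * rhoSeries b x =
      PowerSeries.X * rhoSeries b ⁅x, y⁆ := by
  ext1 n
  have h : PowerSeries.coeff n (rhoSeries b x * rhoSeries b y - rhoSeries b y * rhoSeries b x) =
      ∑ q ∈ Finset.HasAntidiagonal.antidiagonal n,
        (rho b q.1 x * rho b q.2 y - rho b q.2 y * rho b q.1 x) := by
    rw [map_sub, PowerSeries.coeff_mul, PowerSeries.coeff_mul,
      ← Finset.Nat.sum_antidiagonal_swap (f := fun q => PowerSeries.coeff q.1 (rhoSeries b y) * _),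
      ← Finset.sum_sub_distrib]
    simp [rhoSeries]
  rw [h]
  cases n with
  | zero => simp [rho_zero_comm b x y]
  | succ n => rw [sum_rho_commutator, PowerSeries.coeff_succ_X_mul]; simp [rhoSeries]

/-- A faithful representation of `L` by Laurent series of operators on its symmetric algebra. -/
def laurentRep : L →ₗ⁅K⁆ HahnSeries ℤ (Module.End K (MvPolynomial I K)) where
  toFun x := HahnSeries.single (-1) 1 * HahnSeries.ofPowerSeries ℤ _ (rhoSeries b x)
  map_add' x y := by rw [map_add, map_add, mul_add]
  map_smul' c x := by
    have : HahnSeries.ofPowerSeries ℤ _ (c • rhoSeries b x) =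
        c • HahnSeries.ofPowerSeries ℤ _ (rhoSeries b x) :=
      map_smul (HahnSeries.ofPowerSeriesAlg ℤ K) c (rhoSeries b x)
    rw [map_smul, this, RingHom.id_apply]
    ext1
    funext n
    simp only [HahnSeries.coeff_smul, HahnSeries.coeff_single_mul, one_mul]
  map_lie' {x y} := by
    have h := congrArg (HahnSeries.ofPowerSeries ℤ _) (rhoSeries_commutator b x y)
    rw [map_sub, map_mul, map_mul, map_mul, HahnSeries.ofPowerSeries_X] at h
    have hu : (HahnSeries.single (-1 : ℤ) (1 : Module.End K (MvPolynomial I K))) *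
        HahnSeries.single 1 1 = 1 := by
      rw [HahnSeries.single_mul_single]; simp
    exact mul_eq_lie_of_commute (single_one_commute _) hu h

/-- The variable is central, so the poles collect in front: a word of length `n` has a pole of order
at most `n`. -/
theorem prod_laurentRep (l : List L) :
    (l.map (laurentRep b)).prod = HahnSeries.single (-(l.length : ℤ)) 1 *
      HahnSeries.ofPowerSeries ℤ _ (l.map (rhoSeries b)).prod := by
  induction l with
  | nil => simp
  | cons x l ih =>
    have : HahnSeries.single (-((x :: l).length : ℤ)) (1 : Module.End K (MvPolynomial I K)) =
        HahnSeries.single (-1) 1 * HahnSeries.single (-(l.length : ℤ)) 1 := by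
      rw [HahnSeries.single_mul_single, one_mul, List.length_cons, Nat.cast_succ, neg_add_rev]
    rw [List.map_cons, List.prod_cons, ih, List.map_cons, List.prod_cons, map_mul, this]
    exact mul_mul_mul_of_commute (single_one_commute _)

theorem constantCoeff_prod_rhoSeries (l : List L) :
    PowerSeries.constantCoeff (l.map (rhoSeries b)).prod 1 = (l.map (lam b)).prod := by
  induction l with
  | nil => simp
  | cons x l ih =>
    have : PowerSeries.constantCoeff (rhoSeries b x) = rho b 0 x := by
      rw [← PowerSeries.coeff_zero_eq_constantCoeff_apply]; simp [rhoSeries]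
    rw [List.map_cons, List.prod_cons, map_mul, this, Module.End.mul_apply, ih, rho_zero_apply,
      List.map_cons, List.prod_cons, mul_comm]

end PolyOp

namespace UniversalEnvelopingAlgebra

attribute [local instance 100] LieRing.ofAssociativeRing

open PolyOp

variable {K L : Type*} [Field K] [CharZero K] [LieRing L] [LieAlgebra K L]

/-- A linear map `p` from `L` to a commutative algebra extends to the associated graded algebra
of `U(L)`: this is the part of degree `d`. -/
theorem exists_symbol {A : Type*} [CommRing A] [Algebra K A] (p : L →ₗ[K] A) (d : ℕ) :
    ∃ κ : UniversalEnvelopingAlgebra K L →ₗ[K] A,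
      (∀ l : List L, l.length < d → κ (l.map (ι K)).prod = 0) ∧
      ∀ l : List L, l.length = d → κ (l.map (ι K)).prod = (l.map p).prod := by
  let b := Module.Basis.ofVectorSpace K L
  let Θ := lift K (laurentRep b)
  let q := MvPolynomial.aeval (R := K) fun i => p (b i)
  have hq : ∀ x, q (lam b x) = p x := fun x => by
    have : q.toLinearMap ∘ₗ lam b = p := b.ext fun i => by simp [lam_basis, q]
    exact DFunLike.congr_fun this x
  -- Read off the pole of order `d`, apply that operator to `1 ∈ Sym(L)`, then evaluate along `p`.
  let κ : UniversalEnvelopingAlgebra K L →ₗ[K] A :=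
    { toFun := fun u => q ((Θ u).coeff (-(d : ℤ)) 1)
      map_add' := fun u v => by simp
      map_smul' := fun c u => by simp }
  have hΘ : ∀ l : List L, Θ (l.map (ι K)).prod = (l.map (laurentRep b)).prod := fun l => by
    rw [map_list_prod, List.map_map]
    congr 2
    funext x
    exact lift_ι_apply K _ x
  have hκ : ∀ l : List L, κ (l.map (ι K)).prod = q ((HahnSeries.ofPowerSeries ℤ _
      (l.map (rhoSeries b)).prod).coeff ((l.length : ℤ) - d) 1) := fun l => by
    change q ((Θ _).coeff (-(d : ℤ)) 1) = _
    rw [hΘ, prod_laurentRep, HahnSeries.coeff_single_mul, one_mul,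
      sub_neg_eq_add, neg_add_eq_sub]
  refine ⟨κ, fun l hl => ?_, fun l hl => ?_⟩
  · rw [hκ, coeff_ofPowerSeries_of_neg _ (by omega), LinearMap.zero_apply, map_zero]
  · have := HahnSeries.ofPowerSeries_apply_coeff (Γ := ℤ) (l.map (rhoSeries b)).prod 0
    rw [Nat.cast_zero] at this
    rw [hκ, hl, sub_self, this, PowerSeries.coeff_zero_eq_constantCoeff_apply,
      constantCoeff_prod_rhoSeries, map_list_prod, List.map_map]
    congr 2
    funext x
    exact hq x

end UniversalEnvelopingAlgebra

end

/-! ### Filtrations of a universal enveloping algebra -/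

noncomputable section

namespace UniversalEnvelopingAlgebra

attribute [local instance 100] LieRing.ofAssociativeRing

variable (K : Type*) {L L' : Type*} [Field K] [LieRing L] [LieAlgebra K L]
  [LieRing L'] [LieAlgebra K L']

/-- The product in `U(L)` of a list of elements of `L`. -/
def word (l : List L) : UniversalEnvelopingAlgebra K L := (l.map (ι K)).prod

@[simp] theorem word_nil : word K ([] : List L) = 1 := rfl

@[simp] theorem word_cons (x : L) (l : List L) : word K (x :: l) = ι K x * word K l := by
  simp only [word, List.map_cons, List.prod_cons]

theorem word_append_singleton (l : List L) (x : L) :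
    word K (l ++ [x]) = word K l * ι K x := by
  simp only [word, List.map_append, List.prod_append, List.map_cons, List.map_nil,
    List.prod_singleton]

theorem map_word (f : L →ₗ⁅K⁆ L') (l : List L) : map K f (word K l) = word K (l.map f) := by
  induction l with
  | nil => simp
  | cons x l ih => rw [word_cons, map_mul, ih, map_ι, List.map_cons, word_cons]

/-- The span of the words of length less than `d`. -/
def wordFilt (L : Type*) [LieRing L] [LieAlgebra K L] (d : ℕ) :
    Submodule K (UniversalEnvelopingAlgebra K L) :=
  Submodule.span K {w | ∃ l : List L, l.length < d ∧ word K l = w}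

variable {K}

theorem word_mem_wordFilt {l : List L} {d : ℕ} (h : l.length < d) : word K l ∈ wordFilt K L d :=
  Submodule.subset_span ⟨l, h, rfl⟩

theorem wordFilt_mono {d e : ℕ} (h : d ≤ e) : wordFilt K L d ≤ wordFilt K L e :=
  Submodule.span_mono fun _ ⟨l, hl, hw⟩ => ⟨l, hl.trans_le h, hw⟩

theorem ι_mul_mem_wordFilt (x : L) {d : ℕ} {w : UniversalEnvelopingAlgebra K L}
    (hw : w ∈ wordFilt K L d) : ι K x * w ∈ wordFilt K L (d + 1) := by
  induction hw using Submodule.span_induction with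
  | mem w hw =>
    obtain ⟨l, hl, rfl⟩ := hw
    rw [← word_cons]
    exact word_mem_wordFilt (by simpa using hl)
  | zero => rw [mul_zero]; exact zero_mem _
  | add v w _ _ hv hw => rw [mul_add]; exact add_mem hv hw
  | smul c w _ hw => rw [mul_smul_comm]; exact Submodule.smul_mem _ _ hw

theorem exists_mem_wordFilt (w : UniversalEnvelopingAlgebra K L) : ∃ d, w ∈ wordFilt K L d := by
  induction w using induction_left K with
  | one => exact ⟨1, by rw [← word_nil]; exact word_mem_wordFilt Nat.zero_lt_one⟩
  | add v w hv hw =>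
    obtain ⟨d, hd⟩ := hv
    obtain ⟨e, he⟩ := hw
    exact ⟨max d e, add_mem (wordFilt_mono (le_max_left _ _) hd)
      (wordFilt_mono (le_max_right _ _) he)⟩
  | smul c w hw => exact hw.imp fun d hd => Submodule.smul_mem _ _ hd
  | ι_mul x w hw =>
    obtain ⟨d, hd⟩ := hw
    exact ⟨d + 1, ι_mul_mem_wordFilt x hd⟩

/-- Exchanging two adjacent letters costs a word in which they are replaced by their bracket, one
letter shorter. -/
theorem word_sub_word_mem_of_perm {l l' : List L} (h : l.Perm l') :
    word K l - word K l' ∈ wordFilt K L l.length := by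
  induction h with
  | nil => simp
  | cons x h ih => rw [word_cons, word_cons, ← mul_sub]; exact ι_mul_mem_wordFilt x ih
  | swap x y l =>
    have : word K (y :: x :: l) - word K (x :: y :: l) = word K (⁅y, x⁆ :: l) := by
      simp only [word_cons, LieHom.map_lie, LieRing.of_associative_ring_bracket, sub_mul,
        mul_assoc]
    rw [this]
    exact word_mem_wordFilt (by simp)
  | trans h h' ih ih' =>
    rw [← sub_add_sub_cancel]
    rw [← h.length_eq] at ih'
    exact add_mem ih ih'

/-- The left module over `Y` generated by the words of length less than `d`. -/
def filt (Y : Subalgebra K (UniversalEnvelopingAlgebra K L)) (d : ℕ) :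
    Submodule K (UniversalEnvelopingAlgebra K L) :=
  Submodule.span K {w | ∃ u ∈ Y, ∃ l : List L, l.length < d ∧ u * word K l = w}

variable {Y : Subalgebra K (UniversalEnvelopingAlgebra K L)}

theorem mul_word_mem_filt {u : UniversalEnvelopingAlgebra K L} (hu : u ∈ Y) {l : List L} {d : ℕ}
    (hl : l.length < d) : u * word K l ∈ filt Y d :=
  Submodule.subset_span ⟨u, hu, l, hl, rfl⟩

theorem wordFilt_le_filt (d : ℕ) : wordFilt K L d ≤ filt Y d := by
  refine Submodule.span_le.2 ?_
  rintro _ ⟨l, hl, rfl⟩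
  rw [← one_mul (word K l)]
  exact mul_word_mem_filt (one_mem Y) hl

theorem filt_zero : filt Y 0 = ⊥ := by
  simp [filt]

theorem filt_one_le : filt Y 1 ≤ Subalgebra.toSubmodule Y := by
  refine Submodule.span_le.2 ?_
  rintro _ ⟨u, hu, l, hl, rfl⟩
  obtain rfl := List.length_eq_zero_iff.1 (Nat.lt_one_iff.1 hl)
  simpa using hu

theorem mul_mem_filt {u w : UniversalEnvelopingAlgebra K L} (hu : u ∈ Y) {d : ℕ}
    (hw : w ∈ filt Y d) : u * w ∈ filt Y d := by
  induction hw using Submodule.span_induction with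
  | mem w hw =>
    obtain ⟨v, hv, l, hl, rfl⟩ := hw
    rw [← mul_assoc]
    exact mul_word_mem_filt (mul_mem hu hv) hl
  | zero => rw [mul_zero]; exact zero_mem _
  | add v w _ _ hv hw => rw [mul_add]; exact add_mem hv hw
  | smul c w _ hw => rw [mul_smul_comm]; exact Submodule.smul_mem _ _ hw

theorem mul_ι_mem_filt (x : L) {w : UniversalEnvelopingAlgebra K L} {d : ℕ}
    (hw : w ∈ filt Y d) : w * ι K x ∈ filt Y (d + 1) := by
  induction hw using Submodule.span_induction with
  | mem w hw =>
    obtain ⟨v, hv, l, hl, rfl⟩ := hw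
    rw [mul_assoc, ← word_append_singleton]
    exact mul_word_mem_filt hv (by simpa using hl)
  | zero => rw [zero_mul]; exact zero_mem _
  | add v w _ _ hv hw => rw [add_mul]; exact add_mem hv hw
  | smul c w _ hw => rw [smul_mul_assoc]; exact Submodule.smul_mem _ _ hw

/-- A word with last letter in `Y` lies in the left `Y`-module generated by the shorter words. -/
theorem word_mul_ι_mem_filt (l : List L) {x : L} (hx : ι K x ∈ Y) :
    word K l * ι K x ∈ filt Y (l.length + 1) := by
  have h := wordFilt_le_filt (Y := Y) _
    (word_sub_word_mem_of_perm (K := K) (List.perm_append_singleton x l))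
  rw [word_append_singleton, word_cons, List.length_append, List.length_singleton] at h
  rw [← sub_add_cancel (word K l * ι K x) (ι K x * word K l)]
  exact add_mem h (mul_word_mem_filt hx (Nat.lt_succ_self _))

/-! ### Normal forms over `Y` and detection of leading coefficients -/

section Expansion

variable {X : Type*} {z : X → L} {r : L → X →₀ K}

/-- Replace the last letter by its combination of the `z`'s. The difference lies in `Y` and is moved
to the left end at the cost of shorter words. -/
theorem word_mem_span_sup_filt (hz : ∀ y, ι K (y - Finsupp.linearCombination K z (r y)) ∈ Y)
    (l : List L) : word K l ∈ Submodule.span K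
      {w | ∃ l' : List X, l'.length = l.length ∧ word K (l'.map z) = w} ⊔ filt Y l.length := by
  induction l using List.reverseRecOn with
  | nil => exact Submodule.mem_sup_left (Submodule.subset_span ⟨[], rfl, rfl⟩)
  | append_singleton l x ih =>
    rw [word_append_singleton, List.length_append, List.length_singleton]
    obtain ⟨a, ha, g, hg, hag⟩ := Submodule.mem_sup.1 ih
    rw [← hag, add_mul]
    refine add_mem ?_ (Submodule.mem_sup_right (mul_ι_mem_filt x hg))
    clear hag
    induction ha using Submodule.span_induction with
    | mem w hw =>
      obtain ⟨l', hl', rfl⟩ := hw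
      rw [← sub_add_cancel x (Finsupp.linearCombination K z (r x)), map_add, mul_add]
      refine add_mem (Submodule.mem_sup_right ?_) (Submodule.mem_sup_left ?_)
      · have := word_mul_ι_mem_filt (l'.map z) (hz x)
        rwa [List.length_map, hl'] at this
      · rw [Finsupp.linearCombination_apply, Finsupp.sum, map_sum, Finset.mul_sum]
        refine sum_mem fun i _ => ?_
        rw [map_smul, mul_smul_comm, ← word_append_singleton]
        exact Submodule.smul_mem _ _ (Submodule.subset_span ⟨l' ++ [i], by simp [hl'], by simp⟩)
    | zero => rw [zero_mul]; exact zero_mem _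
    | add v w _ _ hv hw => rw [add_mul]; exact add_mem hv hw
    | smul c w _ hw => rw [smul_mul_assoc]; exact Submodule.smul_mem _ _ hw

/-- Expansion with coefficients in `Y` along monomials in a complement. -/
theorem exists_expansion (hz : ∀ y, ι K (y - Finsupp.linearCombination K z (r y)) ∈ Y)
    {d : ℕ} {h : UniversalEnvelopingAlgebra K L} (hh : h ∈ filt Y (d + 1)) :
    ∃ c : Multiset X →₀ UniversalEnvelopingAlgebra K L, (∀ α, c α ∈ Y) ∧
      (∀ α, α.card ≠ d → c α = 0) ∧
      h - c.sum (fun α u => u * word K (α.toList.map z)) ∈ filt Y d := by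
  have hzero : ∀ h ∈ filt Y d, ∃ c : Multiset X →₀ UniversalEnvelopingAlgebra K L,
      (∀ α, c α ∈ Y) ∧ (∀ α, α.card ≠ d → c α = 0) ∧
      h - c.sum (fun α u => u * word K (α.toList.map z)) ∈ filt Y d := fun h hh =>
    ⟨0, fun _ => zero_mem _, fun _ _ => rfl, by simpa using hh⟩
  have hadd : ∀ h h' : UniversalEnvelopingAlgebra K L,
      (∃ c : Multiset X →₀ UniversalEnvelopingAlgebra K L,
        (∀ α, c α ∈ Y) ∧ (∀ α, α.card ≠ d → c α = 0) ∧
        h - c.sum (fun α u => u * word K (α.toList.map z)) ∈ filt Y d) →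
      (∃ c : Multiset X →₀ UniversalEnvelopingAlgebra K L,
        (∀ α, c α ∈ Y) ∧ (∀ α, α.card ≠ d → c α = 0) ∧
        h' - c.sum (fun α u => u * word K (α.toList.map z)) ∈ filt Y d) →
      ∃ c : Multiset X →₀ UniversalEnvelopingAlgebra K L,
        (∀ α, c α ∈ Y) ∧ (∀ α, α.card ≠ d → c α = 0) ∧
        h + h' - c.sum (fun α u => u * word K (α.toList.map z)) ∈ filt Y d := by
    rintro h h' ⟨c, h1, h2, h3⟩ ⟨c', h1', h2', h3'⟩
    refine ⟨c + c', fun α => add_mem (h1 α) (h1' α), fun α hα => ?_, ?_⟩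
    · rw [Finsupp.add_apply, h2 α hα, h2' α hα, add_zero]
    · rw [Finsupp.sum_add_index' (fun _ => zero_mul _) fun _ _ _ => add_mul _ _ _,
        add_sub_add_comm]
      exact add_mem h3 h3'
  have hsmul : ∀ (k : K) (h : UniversalEnvelopingAlgebra K L),
      (∃ c : Multiset X →₀ UniversalEnvelopingAlgebra K L,
        (∀ α, c α ∈ Y) ∧ (∀ α, α.card ≠ d → c α = 0) ∧
        h - c.sum (fun α u => u * word K (α.toList.map z)) ∈ filt Y d) →
      ∃ c : Multiset X →₀ UniversalEnvelopingAlgebra K L,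
        (∀ α, c α ∈ Y) ∧ (∀ α, α.card ≠ d → c α = 0) ∧
        k • h - c.sum (fun α u => u * word K (α.toList.map z)) ∈ filt Y d := by
    rintro k h ⟨c, h1, h2, h3⟩
    refine ⟨k • c, fun α => Subalgebra.smul_mem _ (h1 α) k, fun α hα => ?_, ?_⟩
    · rw [Finsupp.smul_apply, h2 α hα, smul_zero]
    · rw [Finsupp.sum_smul_index' fun _ => zero_mul _]
      simp only [smul_mul_assoc]
      rw [← Finsupp.smul_sum, ← smul_sub]
      exact Submodule.smul_mem _ _ h3
  induction hh using Submodule.span_induction with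
  | zero => exact hzero 0 (zero_mem _)
  | add v w _ _ hv hw => exact hadd v w hv hw
  | smul c w _ hw => exact hsmul c w hw
  | mem w hw =>
    obtain ⟨u, hu, l, hl, rfl⟩ := hw
    rcases Nat.lt_or_eq_of_le (Nat.lt_succ_iff.1 hl) with hl | rfl
    · exact hzero _ (mul_word_mem_filt hu hl)
    obtain ⟨a, ha, g, hg, hag⟩ := Submodule.mem_sup.1 (word_mem_span_sup_filt hz l)
    rw [← hag, mul_add]
    refine hadd _ _ ?_ (hzero _ (mul_mem_filt hu hg))
    clear hag
    induction ha using Submodule.span_induction with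
    | zero => rw [mul_zero]; exact hzero 0 (zero_mem _)
    | add v w _ _ hv hw => rw [mul_add]; exact hadd _ _ hv hw
    | smul c w _ hw => rw [mul_smul_comm]; exact hsmul c _ hw
    | mem w hw =>
      obtain ⟨l', hl', rfl⟩ := hw
      -- The chosen ordering `toList` of the multiset differs from `l'` by a permutation, which only
      -- matters in lower degree.
      refine ⟨Finsupp.single (l' : Multiset X) u, fun α => ?_, fun α hα => ?_, ?_⟩
      · classical
        rw [Finsupp.single_apply]
        split_ifs
        exacts [hu, zero_mem _]
      · refine Finsupp.single_eq_of_ne fun h => hα ?_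
        rw [h, Multiset.coe_card, hl']
      · rw [Finsupp.sum_single_index (zero_mul _), ← mul_sub, ← hl', ← List.length_map (f := z)]
        refine mul_mem_filt hu (wordFilt_le_filt _ (word_sub_word_mem_of_perm ?_))
        exact List.Perm.map _ (Multiset.coe_eq_coe.1 (Multiset.coe_toList _)).symm

/-- If `Ψ` detects the leading coefficients of an expansion, then its kernel in degree `d`
consists of elements of smaller degree. -/
theorem mem_filt_of_map_eq_zero
    (hz : ∀ y, ι K (y - Finsupp.linearCombination K z (r y)) ∈ Y)
    {V : Type*} [AddCommGroup V] [Module K V] {d : ℕ}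
    (θ : UniversalEnvelopingAlgebra K L →ₗ[K] V) (hθ : ∀ u ∈ Y, θ u = 0 → u = 0)
    (Ψ : UniversalEnvelopingAlgebra K L →ₗ[K] MvPolynomial X K ⊗[K] V)
    (hlt : ∀ u ∈ Y, ∀ l : List L, l.length < d → Ψ (u * word K l) = 0)
    (heq : ∀ u ∈ Y, ∀ l : List X, l.length = d →
      Ψ (u * word K (l.map z)) = (l.map MvPolynomial.X).prod ⊗ₜ θ u)
    {h : UniversalEnvelopingAlgebra K L} (hh : h ∈ filt Y (d + 1)) (hΨ : Ψ h = 0) :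
    h ∈ filt Y d := by
  classical
  obtain ⟨c, h1, h2, h3⟩ := exists_expansion hz hh
  have hker : ∀ w ∈ filt Y d, Ψ w = 0 := fun w hw => by
    have : filt Y d ≤ LinearMap.ker Ψ := by
      refine Submodule.span_le.2 ?_
      rintro _ ⟨u, hu, l, hl, rfl⟩
      exact hlt u hu l hl
    exact this hw
  have hs := hker _ h3
  rw [map_sub, hΨ, zero_sub, neg_eq_zero, Finsupp.sum, map_sum] at hs
  have hX : ∀ α : Multiset X, (α.toList.map (MvPolynomial.X (R := K))).prod =
      MvPolynomial.monomial (Multiset.toFinsupp α) 1 := fun α => by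
    rw [← Multiset.prod_coe, ← Multiset.map_coe, Multiset.coe_toList]
    induction α using Multiset.induction_on with
    | empty => simp
    | cons a s ih =>
      rw [Multiset.map_cons, Multiset.prod_cons, ih, ← Multiset.singleton_add,
        map_add, Multiset.toFinsupp_singleton, MvPolynomial.X, MvPolynomial.monomial_mul, one_mul]
  have hc : c = 0 := by
    ext1 β
    by_cases hβ : β.card = d
    · refine hθ _ (h1 β) ?_
      -- Taking the coefficient of the monomial of `β` in the first tensor factor isolates `θ (c
      -- β)`.
      have hs' := congrArg (fun t => TensorProduct.lid K V
        ((MvPolynomial.lcoeff K (Multiset.toFinsupp β)).rTensor V t)) hs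
      simp only [map_sum, map_zero] at hs'
      rw [Finset.sum_congr rfl (g := fun α => if α = β then θ (c α) else 0)] at hs'
      · rw [Finset.sum_ite_eq'] at hs'
        split_ifs at hs' with hm
        · exact hs'
        · rw [Finsupp.notMem_support_iff.1 hm, map_zero]
      · intro α hα
        have hd : α.toList.length = d := by
          rw [Multiset.length_toList]
          by_contra hne
          exact Finsupp.mem_support_iff.1 hα (h2 α hne)
        rw [heq _ (h1 α) _ hd, hX]
        simp [MvPolynomial.lcoeff, MvPolynomial.coeff_monomial, ite_smul]
    · exact h2 β hβ
  simpa [hc] using h3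

end Expansion

end UniversalEnvelopingAlgebra

end

/-! ### Injectivity of `U(i)` and the Hopf kernel of `U(f)` -/

noncomputable section

/-- The image of a linear map has a basis which lifts to the source and extends to coordinates
on the target. -/
theorem LinearMap.exists_coordinates {K V V' : Type*} [Field K] [AddCommGroup V] [Module K V]
    [AddCommGroup V'] [Module K V'] (f : V →ₗ[K] V') :
    ∃ (X : Set f.range) (z : X → V) (r : V' →ₗ[K] X →₀ K),
      (∀ x, r (f (z x)) = Finsupp.single x 1) ∧
      ∀ y, f (y - Finsupp.linearCombination K z (r (f y))) = 0 := by
  let B := Module.Basis.ofVectorSpace K f.range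
  obtain ⟨r, hr⟩ := LinearMap.exists_extend B.repr.toLinearMap
  have hr' : ∀ w : f.range, r w = B.repr w := fun w => DFunLike.congr_fun hr w
  choose z hz using fun x => (B x).2
  refine ⟨_, z, r, fun x => ?_, fun y => ?_⟩
  · rw [hz, hr', B.repr_self]
  · have h1 := congrArg Subtype.val (B.linearCombination_repr ⟨f y, f.mem_range_self y⟩)
    rw [← hr', Finsupp.linearCombination_apply, Finsupp.sum] at h1
    rw [map_sub, sub_eq_zero, Finsupp.linearCombination_apply, Finsupp.sum, map_sum]
    refine h1.symm.trans ?_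
    simp [hz]

theorem List.prod_map_linearCombination_X {K V V' X : Type*} [Field K] [AddCommGroup V']
    [Module K V'] {f : V → V'} {z : X → V} {r : V' →ₗ[K] X →₀ K}
    (hr : ∀ x, r (f (z x)) = Finsupp.single x 1) (l : List X) :
    (((l.map z).map f).map (Finsupp.linearCombination K
      (MvPolynomial.X (R := K) (σ := X)) ∘ₗ r)).prod = (l.map MvPolynomial.X).prod := by
  rw [List.map_map, List.map_map]
  congr 2
  funext x
  simp [hr]

namespace UniversalEnvelopingAlgebra

attribute [local instance 100] LieRing.ofAssociativeRing

variable {K L L' : Type*} [Field K] [LieRing L] [LieAlgebra K L] [LieRing L'] [LieAlgebra K L']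

/-- A morphism of Lie algebras which is injective stays so on enveloping algebras. -/
theorem map_injective [CharZero K] {g : L →ₗ⁅K⁆ L'} (hg : Function.Injective g) :
    Function.Injective (map K g) := by
  refine (injective_iff_map_eq_zero (map K g)).2 fun v hv => ?_
  obtain ⟨X, z, r, hr, hz⟩ := (g : L →ₗ[K] L').exists_coordinates
  replace hr : ∀ x, r (g (z x)) = Finsupp.single x 1 := hr
  replace hz : ∀ y, g (y - Finsupp.linearCombination K z (r (g y))) = 0 := hz
  -- As `g` is injective, the `z`'s span `L`, so the coefficients can be taken to be scalars; on
  -- these the counit serves as the faithful `θ`.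
  have hz' : ∀ y, ι K (y - Finsupp.linearCombination K z (r (g y))) ∈
      (⊥ : Subalgebra K (UniversalEnvelopingAlgebra K L)) := fun y => by
    rw [(injective_iff_map_eq_zero g).1 hg _ (hz y), map_zero]
    exact zero_mem _
  have step : ∀ d, v ∈ filt (⊥ : Subalgebra K (UniversalEnvelopingAlgebra K L)) (d + 1) →
      v ∈ filt (⊥ : Subalgebra K (UniversalEnvelopingAlgebra K L)) d := fun d hd => by
    obtain ⟨κ, hlt, heq⟩ := exists_symbol (K := K) (Finsupp.linearCombination K
      (MvPolynomial.X (R := K) (σ := X)) ∘ₗ r) d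
    have hΨ : ∀ u ∈ (⊥ : Subalgebra K (UniversalEnvelopingAlgebra K L)), ∀ l : List L,
        κ (map K g (u * word K l)) =
          Coalgebra.counit (R := K) u • κ (((l.map g).map (ι K)).prod) := by
      rintro u hu l
      obtain ⟨c, rfl⟩ := Algebra.mem_bot.1 hu
      rw [← Algebra.smul_def, map_smul, map_smul, map_word, Bialgebra.counit_algebraMap]
      rfl
    refine mem_filt_of_map_eq_zero (r := fun y => r (g y)) hz' (V := K) (d := d)
      (Coalgebra.counit (R := K)) (fun u hu h => ?_)
      ((TensorProduct.mk K (MvPolynomial X K) K).flip 1 ∘ₗ κ ∘ₗ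
        (map K g : UniversalEnvelopingAlgebra K L →ₗ[K] UniversalEnvelopingAlgebra K L'))
      (fun u hu l hl => ?_) (fun u hu l hl => ?_) hd ?_
    · obtain ⟨c, rfl⟩ := Algebra.mem_bot.1 hu
      rw [Bialgebra.counit_algebraMap] at h
      rw [h, map_zero]
    · change κ (map K g (u * word K l)) ⊗ₜ[K] (1 : K) = 0
      rw [hΨ u hu, hlt _ (by simpa using hl), smul_zero, TensorProduct.zero_tmul]
    · change κ (map K g (u * word K _)) ⊗ₜ[K] (1 : K) = _
      rw [hΨ u hu, heq _ (by simpa using hl), List.prod_map_linearCombination_X hr, TensorProduct.smul_tmul,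
        smul_eq_mul, mul_one]
    · change κ (map K g v) ⊗ₜ[K] (1 : K) = 0
      rw [hv, map_zero, TensorProduct.zero_tmul]
  obtain ⟨d, hd⟩ := exists_mem_wordFilt v
  replace hd := wordFilt_le_filt (Y := ⊥) d hd
  induction d with
  | zero => simpa [filt_zero] using hd
  | succ d ih => exact ih (step d hd)

/-- The algebra map `h ↦ U(f)(h₁) ⊗ h₂`. -/
def coaction (f : L →ₗ⁅K⁆ L') : UniversalEnvelopingAlgebra K L →ₐ[K]
    UniversalEnvelopingAlgebra K L' ⊗[K] UniversalEnvelopingAlgebra K L :=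
  (Algebra.TensorProduct.map (map K f : UniversalEnvelopingAlgebra K L →ₐ[K] _)
    (AlgHom.id K _)).comp (Bialgebra.comulAlgHom K _)

theorem coaction_ι (f : L →ₗ⁅K⁆ L') (x : L) :
    coaction f (ι K x) = ι K (f x) ⊗ₜ 1 + 1 ⊗ₜ ι K x := by
  have h : (map K f : UniversalEnvelopingAlgebra K L →ₐ[K] _) (ι K x) = ι K (f x) := map_ι K f x
  rw [coaction, AlgHom.comp_apply, Bialgebra.comulAlgHom_apply, comul_ι, map_add,
    Algebra.TensorProduct.map_tmul, Algebra.TensorProduct.map_tmul, h, map_one, map_one]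
  rfl

theorem mem_HKer_map {f : L →ₗ⁅K⁆ L'} {h : UniversalEnvelopingAlgebra K L} :
    h ∈ HKer (map K f) ↔ coaction f h = 1 ⊗ₜ h := Iff.rfl

theorem ι_mem_HKer {f : L →ₗ⁅K⁆ L'} {x : L} (hx : f x = 0) : ι K x ∈ HKer (map K f) := by
  rw [mem_HKer_map, coaction_ι, hx, map_zero, TensorProduct.zero_tmul, zero_add]

theorem map_incl_mem_HKer (f : L →ₗ⁅K⁆ L') (u : UniversalEnvelopingAlgebra K f.ker) :
    map K f.ker.incl u ∈ HKer (map K f) := by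
  induction u using induction_left K with
  | one => rw [map_one]; exact one_mem _
  | add a b ha hb => rw [map_add]; exact add_mem ha hb
  | smul c a ha => rw [map_smul]; exact Subalgebra.smul_mem _ ha c
  | ι_mul x a ha =>
    rw [map_mul, map_ι]
    exact mul_mem (ι_mem_HKer (f.mem_ker.1 x.2)) ha

theorem range_map_incl_le_HKer (f : L →ₗ⁅K⁆ L') :
    (map K f.ker.incl : UniversalEnvelopingAlgebra K f.ker →ₐ[K]
      UniversalEnvelopingAlgebra K L).range ≤ HKer (map K f) := by
  rintro _ ⟨u, rfl⟩
  exact map_incl_mem_HKer f u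

/-- Tensors whose first factor lies in the span of the words of length less than `d`. -/
def tensorFilt (K L L' : Type*) [Field K] [LieRing L] [LieAlgebra K L] [LieRing L']
    [LieAlgebra K L'] (d : ℕ) :
    Submodule K (UniversalEnvelopingAlgebra K L' ⊗[K] UniversalEnvelopingAlgebra K L) :=
  Submodule.span K {t | ∃ w ∈ wordFilt K L' d, ∃ v, w ⊗ₜ v = t}

theorem tensorFilt_mono {d e : ℕ} (h : d ≤ e) : tensorFilt K L L' d ≤ tensorFilt K L L' e :=
  Submodule.span_mono fun _ ⟨w, hw, v, hv⟩ => ⟨w, wordFilt_mono h hw, v, hv⟩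

theorem tmul_mem_tensorFilt {w : UniversalEnvelopingAlgebra K L'} {d : ℕ}
    (hw : w ∈ wordFilt K L' d) (v : UniversalEnvelopingAlgebra K L) :
    w ⊗ₜ v ∈ tensorFilt K L L' d :=
  Submodule.subset_span ⟨w, hw, v, rfl⟩

theorem ι_tmul_one_mul_mem_tensorFilt (y : L') {d : ℕ}
    {t : UniversalEnvelopingAlgebra K L' ⊗[K] UniversalEnvelopingAlgebra K L}
    (ht : t ∈ tensorFilt K L L' d) : (ι K y ⊗ₜ 1) * t ∈ tensorFilt K L L' (d + 1) := by
  induction ht using Submodule.span_induction with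
  | mem t ht =>
    obtain ⟨w, hw, v, rfl⟩ := ht
    rw [Algebra.TensorProduct.tmul_mul_tmul]
    exact tmul_mem_tensorFilt (ι_mul_mem_wordFilt y hw) _
  | zero => rw [mul_zero]; exact zero_mem _
  | add v w _ _ hv hw => rw [mul_add]; exact add_mem hv hw
  | smul c w _ hw => rw [mul_smul_comm]; exact Submodule.smul_mem _ _ hw

theorem one_tmul_mul_mem_tensorFilt (u : UniversalEnvelopingAlgebra K L) {d : ℕ}
    {t : UniversalEnvelopingAlgebra K L' ⊗[K] UniversalEnvelopingAlgebra K L}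
    (ht : t ∈ tensorFilt K L L' d) : (1 ⊗ₜ u) * t ∈ tensorFilt K L L' d := by
  induction ht using Submodule.span_induction with
  | mem t ht =>
    obtain ⟨w, hw, v, rfl⟩ := ht
    rw [Algebra.TensorProduct.tmul_mul_tmul, one_mul]
    exact tmul_mem_tensorFilt hw _
  | zero => rw [mul_zero]; exact zero_mem _
  | add v w _ _ hv hw => rw [mul_add]; exact add_mem hv hw
  | smul c w _ hw => rw [mul_smul_comm]; exact Submodule.smul_mem _ _ hw

/-- The leading term of the coaction on a word. -/
theorem coaction_word_sub_mem (f : L →ₗ⁅K⁆ L') (l : List L) :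
    coaction f (word K l) - word K (l.map f) ⊗ₜ 1 ∈ tensorFilt K L L' l.length := by
  induction l with
  | nil => simp [Algebra.TensorProduct.one_def]
  | cons x l ih =>
    have h : coaction f (word K (x :: l)) - word K ((x :: l).map f) ⊗ₜ 1 =
        (ι K (f x) ⊗ₜ 1) * (coaction f (word K l) - word K (l.map f) ⊗ₜ 1) +
        word K (l.map f) ⊗ₜ ι K x +
        (1 ⊗ₜ ι K x) * (coaction f (word K l) - word K (l.map f) ⊗ₜ 1) := by
      rw [word_cons, map_mul, coaction_ι, List.map_cons, word_cons, add_mul, mul_sub, mul_sub,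
        Algebra.TensorProduct.tmul_mul_tmul, Algebra.TensorProduct.tmul_mul_tmul, one_mul,
        one_mul, mul_one]
      abel
    rw [h]
    refine add_mem (add_mem (ι_tmul_one_mul_mem_tensorFilt _ ih)
      (tmul_mem_tensorFilt (word_mem_wordFilt ?_) _))
      (tensorFilt_mono (Nat.le_succ _) (one_tmul_mul_mem_tensorFilt _ ih))
    simp

/-- The Hopf kernel of `U(f)` is the image of `U(ker f)`. -/
theorem range_map_incl_eq_HKer [CharZero K] (f : L →ₗ⁅K⁆ L') :
    (map K f.ker.incl : UniversalEnvelopingAlgebra K f.ker →ₐ[K]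
      UniversalEnvelopingAlgebra K L).range = HKer (map K f) := by
  refine le_antisymm (range_map_incl_le_HKer f) fun h hh => ?_
  set Y := (map K f.ker.incl : UniversalEnvelopingAlgebra K f.ker →ₐ[K]
    UniversalEnvelopingAlgebra K L).range
  obtain ⟨X, z, r, hr, hz⟩ := (f : L →ₗ[K] L').exists_coordinates
  replace hr : ∀ x, r (f (z x)) = Finsupp.single x 1 := hr
  replace hz : ∀ y, f (y - Finsupp.linearCombination K z (r (f y))) = 0 := hz
  have hz' : ∀ y, ι K (y - Finsupp.linearCombination K z (r (f y))) ∈ Y := fun y =>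
    ⟨ι K (⟨_, f.mem_ker.2 (hz y)⟩ : f.ker), map_ι K f.ker.incl _⟩
  have step : ∀ d, 0 < d → h ∈ filt Y (d + 1) → h ∈ filt Y d := fun d hpos hd => by
    obtain ⟨κ, hlt, heq⟩ := exists_symbol (K := K) (Finsupp.linearCombination K
      (MvPolynomial.X (R := K) (σ := X)) ∘ₗ r) d
    have hker : ∀ t ∈ tensorFilt K L L' d, κ.rTensor _ t = 0 := fun t ht => by
      have : tensorFilt K L L' d ≤ LinearMap.ker (κ.rTensor _) := by
        refine Submodule.span_le.2 ?_
        rintro _ ⟨w, hw, v, rfl⟩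
        have : wordFilt K L' d ≤ LinearMap.ker κ := by
          refine Submodule.span_le.2 ?_
          rintro _ ⟨l, hl, rfl⟩
          exact hlt l hl
        change κ.rTensor _ (w ⊗ₜ v) = 0
        rw [LinearMap.rTensor_tmul, LinearMap.mem_ker.1 (this hw), TensorProduct.zero_tmul]
      exact this ht
    -- The coaction sends `u ∈ Y` to `1 ⊗ u` and a word to its image tensor `1` plus terms that `κ`
    -- kills.
    have hΨ : ∀ u ∈ Y, ∀ l : List L, l.length ≤ d →
        κ.rTensor _ (coaction f (u * word K l)) = κ (word K (l.map f)) ⊗ₜ u := by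
      intro u hu l hl
      have hm := hker _ (one_tmul_mul_mem_tensorFilt u
        (tensorFilt_mono hl (coaction_word_sub_mem f l)))
      rw [mul_sub, Algebra.TensorProduct.tmul_mul_tmul, one_mul, mul_one, map_sub,
        sub_eq_zero, LinearMap.rTensor_tmul] at hm
      rw [map_mul, mem_HKer_map.1 (range_map_incl_le_HKer f hu), hm]
    refine mem_filt_of_map_eq_zero (r := fun y => r (f y)) hz' (d := d)
      LinearMap.id (fun u _ h => h)
      (κ.rTensor _ ∘ₗ (coaction f).toLinearMap)
      (fun u hu l hl => ?_) (fun u hu l hl => ?_) hd ?_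
    · refine (hΨ u hu l hl.le).trans ?_
      rw [word, hlt _ (by simpa using hl), TensorProduct.zero_tmul]
    · refine (hΨ u hu _ (by simpa using hl.le)).trans ?_
      rw [word, heq _ (by simpa using hl), List.prod_map_linearCombination_X hr]
      rfl
    -- Here `0 < d` is essential: `1` is the empty word, so `κ 1 = 0`.
    · change κ.rTensor _ (coaction f h) = 0
      rw [mem_HKer_map.1 hh, LinearMap.rTensor_tmul, ← word_nil, word, hlt [] hpos,
        TensorProduct.zero_tmul]
  obtain ⟨d, hd⟩ := exists_mem_wordFilt h
  -- The index is raised by one so that the descent stops at `filt Y 1`, which is contained in `Y`.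
  replace hd : h ∈ filt Y (d + 1) := wordFilt_le_filt _ (wordFilt_mono (Nat.le_succ d) hd)
  induction d with
  | zero => exact filt_one_le hd
  | succ d ih => exact ih (step (d + 1) d.succ_pos hd)

end UniversalEnvelopingAlgebra

end

/-! ### The kernel in the category of cocommutative Hopf algebras -/

section HopfKernel

variable {K A H N B : Type*} [Field K] [Ring A] [HopfAlgebra K A] [Ring H] [HopfAlgebra K H]
  [Ring N] [HopfAlgebra K N] [Ring B] [HopfAlgebra K B]

/-- In Sweedler notation, `p(g(a₁)) ⊗ g(a₂) = 1 ⊗ g(ε(a₁) a₂) = 1 ⊗ g(a)`. -/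
theorem mem_HKer_of_comp_trivial (p : H →ₐc[K] B) (g : A →ₐc[K] H)
    (hg : ∀ a, p (g a) = algebraMap K B (Coalgebra.counit (R := K) a)) (a : A) :
    g a ∈ HKer p := by
  have hpg : (p : H →ₗ[K] B) ∘ₗ (g : A →ₗ[K] H) =
      Algebra.linearMap K B ∘ₗ Coalgebra.counit := LinearMap.ext hg
  have h1 : TensorProduct.map (g : A →ₗ[K] H) (g : A →ₗ[K] H) (Coalgebra.comul (R := K) a) =
      Coalgebra.comul (R := K) (g a) := CoalgHomClass.map_comp_comul_apply g a
  have h2 : TensorProduct.map (Algebra.linearMap K B) (g : A →ₗ[K] H)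
      ((Coalgebra.counit (R := K)).rTensor A (Coalgebra.comul (R := K) a)) = 1 ⊗ₜ g a := by
    rw [Coalgebra.rTensor_counit_comul, TensorProduct.map_tmul, Algebra.linearMap_apply, map_one]
    rfl
  rw [mem_HKer, ← h1, ← h2, LinearMap.rTensor, TensorProduct.map_map, TensorProduct.map_map, hpg]
  rfl

/-- The algebra map `l` exists by injectivity of `j`. It respects comultiplication because this
holds after applying `j ⊗ j`, which is injective over a field. -/
theorem BialgHom.exists_lift_of_injective (j : N →ₐc[K] H) (hj : Function.Injective j)
    (g : A →ₐc[K] H) (hg : ∀ a, g a ∈ (j : N →ₐ[K] H).range) :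
    ∃ l : A →ₐc[K] N, ∀ a, j (l a) = g a := by
  let e := AlgEquiv.ofInjective (j : N →ₐ[K] H) hj
  let l : A →ₐ[K] N := e.symm.toAlgHom.comp ((g : A →ₐ[K] H).codRestrict _ hg)
  have hl : ∀ a, j (l a) = g a := fun a =>
    congrArg Subtype.val (e.apply_symm_apply ((g : A →ₐ[K] H).codRestrict _ hg a))
  have hjl : (j : N →ₗ[K] H) ∘ₗ l.toLinearMap = (g : A →ₗ[K] H) := LinearMap.ext hl
  have hjj : Function.Injective (TensorProduct.map (j : N →ₗ[K] H) (j : N →ₗ[K] H)) :=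
    TensorProduct.map_injective_of_flat_flat _ _ hj hj
  refine ⟨BialgHom.ofAlgHom l (AlgHom.ext fun a => ?_) (AlgHom.ext fun a => hjj ?_), hl⟩
  · have h1 := CoalgHomClass.counit_comp_apply j (l a)
    have h2 := CoalgHomClass.counit_comp_apply g a
    rw [hl, h2] at h1
    exact h1.symm
  · have h1 := CoalgHomClass.map_comp_comul_apply j (l a)
    have h2 := CoalgHomClass.map_comp_comul_apply g a
    rw [hl, ← h2] at h1
    refine Eq.trans ?_ h1.symm
    change TensorProduct.map (j : N →ₗ[K] H) (j : N →ₗ[K] H)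
      (TensorProduct.map l.toLinearMap l.toLinearMap (Coalgebra.comul (R := K) a)) = _
    rw [TensorProduct.map_map, hjl]

end HopfKernel

theorem UniversalEnvelopingAlgebra.map_map_incl {K L L' : Type*} [Field K] [LieRing L]
    [LieAlgebra K L] [LieRing L'] [LieAlgebra K L'] (f : L →ₗ⁅K⁆ L')
    (u : UniversalEnvelopingAlgebra K f.ker) :
    map K f (map K f.ker.incl u) = algebraMap K _ (Coalgebra.counit (R := K) u) := by
  induction u using induction_left K with
  | one => rw [map_one, map_one, Bialgebra.counit_one, map_one]
  | add a b ha hb => simp only [map_add, ha, hb]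
  | smul c a ha =>
    rw [map_smul, map_smul, map_smul, ha, smul_eq_mul, map_mul, Algebra.smul_def]
  | ι_mul x a _ =>
    have : f (f.ker.incl x) = 0 := f.mem_ker.1 x.2
    rw [map_mul, map_mul, map_ι, map_ι, Bialgebra.counit_mul, counit_ι, this, map_zero, zero_mul,
      zero_mul, map_zero]

namespace CocommHopfAlgCat

variable {K : Type u} [Field K] {L L' : Type v} [LieRing L] [LieAlgebra K L] [LieRing L']
  [LieAlgebra K L']

theorem Umap_incl_comp_Umap (f : L →ₗ⁅K⁆ L') : Umap K f.ker.incl ≫ Umap K f = 0 := by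
  apply ObjectProperty.hom_ext
  apply HopfAlgCat.hom_ext
  refine BialgHom.ext fun u => ?_
  exact UniversalEnvelopingAlgebra.map_map_incl f u

theorem nonempty_isLimit_kernelFork [CharZero K] (f : L →ₗ⁅K⁆ L') :
    Nonempty (IsLimit (KernelFork.ofι (Umap K f.ker.incl) (Umap_incl_comp_Umap f))) := by
  have hinj : Function.Injective (UniversalEnvelopingAlgebra.map K f.ker.incl) :=
    UniversalEnvelopingAlgebra.map_injective Subtype.val_injective
  have hmono : Mono (Umap K f.ker.incl) := ⟨fun {Z} g h hgh => by
    apply ObjectProperty.hom_ext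
    apply HopfAlgCat.hom_ext
    refine BialgHom.ext fun a => hinj ?_
    exact congrArg (fun k : Z ⟶ U K L => k.hom.toBialgHom a) hgh⟩
  have hex : ∀ {A : CocommHopfAlgCat.{u, max u v} K} (k : A ⟶ U K L), k ≫ Umap K f = 0 →
      ∃ l : A ⟶ U K f.ker, l ≫ Umap K f.ker.incl = k := fun {A} k hk => by
    obtain ⟨l, hl⟩ := BialgHom.exists_lift_of_injective
      (UniversalEnvelopingAlgebra.map K f.ker.incl) hinj k.hom.toBialgHom fun a => by
        rw [UniversalEnvelopingAlgebra.range_map_incl_eq_HKer]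
        exact mem_HKer_of_comp_trivial _ k.hom.toBialgHom (fun a =>
          congrArg (fun q : A ⟶ U K L' => q.hom.toBialgHom a) hk) a
    refine ⟨ObjectProperty.homMk (HopfAlgCat.ofHom l), ?_⟩
    apply ObjectProperty.hom_ext
    apply HopfAlgCat.hom_ext
    exact BialgHom.ext hl
  exact ⟨KernelFork.IsLimit.ofι' _ _ fun k hk => ⟨(hex k hk).choose, (hex k hk).choose_spec⟩⟩

end CocommHopfAlgCat

theorem proposition4p3 {K : Type u} [Field K] [IsAlgClosed K] [CharZero K]
    {L L' : Type v} [LieRing L] [LieAlgebra K L] [LieRing L'] [LieAlgebra K L']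
    (f : L →ₗ⁅K⁆ L') :
    -- `U(ker f) → U(L)` is a kernel of `U(f)` in the category of cocommutative Hopf algebras
    (∃ w : CocommHopfAlgCat.Umap K f.ker.incl ≫ CocommHopfAlgCat.Umap K f = 0,
      Nonempty (IsLimit (KernelFork.ofι (CocommHopfAlgCat.Umap K f.ker.incl) w))) ∧
    -- `U(ker f) → U(L)` is an isomorphism onto `HKer(U(f)) = {h | U(f)(h₁) ⊗ h₂ = 1 ⊗ h}`
    Function.Injective (UniversalEnvelopingAlgebra.map K f.ker.incl) ∧
    ((UniversalEnvelopingAlgebra.map K f.ker.incl :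
      UniversalEnvelopingAlgebra K f.ker →ₐ[K] UniversalEnvelopingAlgebra K L)).range =
        HKer (UniversalEnvelopingAlgebra.map K f) :=
  ⟨⟨CocommHopfAlgCat.Umap_incl_comp_Umap f, CocommHopfAlgCat.nonempty_isLimit_kernelFork f⟩,
    UniversalEnvelopingAlgebra.map_injective Subtype.val_injective,
    UniversalEnvelopingAlgebra.range_map_incl_eq_HKer f⟩
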